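/- Let $X$ be a projective algebraic surface over $\mathbb C$ and let $C\subset X$ be a rational cuspidal curve, i.e. a reduced and irreducible curve, birational to $\mathbb P^1$, which is locally irreducible (has exactly one branch) at each of its singular points $z_1,\dots,z_n$. For each $j$ let $S_j\subset\mathbb Z_{\ge 0}$ be the semigroup of $z_j$, i.e. the set of all intersection multiplicities at $z_j$ of $C$ with curve germs not containing $C$; equivalently, $S_j=\{\operatorname{length}(\mathcal O_{C,z_j}/(f)) : 0\ne f\in\mathcal O_{C,z_j}\}$. For a semigroup $S\subset\mathbb Z_{\ge0}$ put $R_S(k)=\#(S\cap[0,k))$ for $k\in\mathbb Z$, for functions $R_1,R_2\colon\mathbb Z\to\mathbb Z$ bounded from below put $(R_1\diamond R_2)(k)=\min_{l\in\mathbb Z}\bigl(R_1(l)+R_2(k-l)\bigr)$, and let \[R=R_{S_1}\diamond R_{S_2}\diamond\dots\diamond R_{S_n}\] (if $C$ is smooth, so that $n=0$, let $R=R_{\mathbb Z_{\ge 0}}$, i.e. $R(k)=\max(k,0)$). Let $\mathcal L$ be a line bundle on $X$ such that $t:=\langle c_1(\mathcal L),C\rangle=\deg(\mathcal L|_C)>0$,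 such that $\Gamma(X,\mathcal L)\neq 0$, and such that no nonzero global section of $\mathcal L$ vanishes identically on $C$. Then $\Gamma(X,\mathcal L)$ is finite-dimensional and \[R(t+1)\ \ge\ \dim_{\mathbb C}\Gamma(X,\mathcal L).\] -/

import Mathlib

open CategoryTheory AlgebraicGeometry TopologicalSpace

noncomputable section

attribute [local instance] MvPolynomial.gradedAlgebra

/-! ### Projective varieties over `ℂ` -/

/-- The structure morphism of the projective space `ℙⁿ = Proj ℂ[x₀, …, xₙ]` over `ℂ`. -/
def projectiveSpaceHom (n : ℕ) :
    Proj (MvPolynomial.homogeneousSubmodule (Fin (n + 1)) ℂ) ⟶ Spec (.of ℂ) :=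
  Proj.toSpecZero (MvPolynomial.homogeneousSubmodule (Fin (n + 1)) ℂ) ≫
    Spec.map (CommRingCat.ofHom
      (algebraMap ℂ (MvPolynomial.homogeneousSubmodule (Fin (n + 1)) ℂ 0)))

/-- A (possibly singular) projective variety over `ℂ`: an integral `ℂ`-scheme that is isomorphic
over `ℂ` to a closed subscheme of some `ℙⁿ`. -/
structure ProjectiveVariety where
  /-- The underlying scheme. -/
  scheme : Scheme.{0}
  /-- The structure morphism. -/
  hom : scheme ⟶ Spec (.of ℂ)
  isIntegral : IsIntegral scheme
  isProjective : ∃ (n : ℕ)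
    (j : scheme ⟶ Proj (MvPolynomial.homogeneousSubmodule (Fin (n + 1)) ℂ)),
      IsClosedImmersion j ∧ j ≫ projectiveSpaceHom n = hom

instance (X : ProjectiveVariety) : IsIntegral X.scheme := X.isIntegral

instance (n : ℕ) : LocallyOfFiniteType (projectiveSpaceHom n) := by
  have ht : IsScalarTower ℂ (MvPolynomial.homogeneousSubmodule (Fin (n + 1)) ℂ 0)
      (MvPolynomial (Fin (n + 1)) ℂ) :=
    ⟨fun a b c => smul_mul_assoc a (b : MvPolynomial (Fin (n + 1)) ℂ) c⟩
  have h0 : Algebra.FiniteType (MvPolynomial.homogeneousSubmodule (Fin (n + 1)) ℂ 0)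
      (MvPolynomial (Fin (n + 1)) ℂ) :=
    Algebra.FiniteType.of_restrictScalars_finiteType ℂ _ _
  have h1 : LocallyOfFiniteType (Spec.map (CommRingCat.ofHom
      (algebraMap ℂ (MvPolynomial.homogeneousSubmodule (Fin (n + 1)) ℂ 0)))) := by
    rw [HasRingHomProperty.Spec_iff (P := @LocallyOfFiniteType)]
    refine RingHom.FiniteType.of_surjective _ ?_
    rintro ⟨p, hp⟩
    rw [MvPolynomial.mem_homogeneousSubmodule] at hp
    refine ⟨MvPolynomial.coeff 0 p, Subtype.ext ?_⟩
    exact ((MvPolynomial.totalDegree_eq_zero_iff_eq_C).mp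
      (Nat.le_zero.mp hp.totalDegree_le)).symm
  unfold projectiveSpaceHom
  infer_instance

/-- A projective variety over `ℂ` is locally Noetherian. -/
instance (X : ProjectiveVariety) : IsLocallyNoetherian X.scheme := by
  obtain ⟨n, j, hj, h⟩ := X.isProjective
  have : LocallyOfFiniteType X.hom := h ▸ inferInstance
  exact LocallyOfFiniteType.isLocallyNoetherian X.hom

/-! ### Line bundles and their sections -/

section LineBundles

variable {X : Scheme.{0}}

/-- Restriction of a section of `L` over `U` to a smaller open set `V`. -/
def resSection (L : X.Modules) {U V : X.Opens} (h : V ≤ U) (e : Γ(L, U)) : Γ(L, V) :=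
  L.presheaf.map (homOfLE h).op e

/-- `e` is a frame of `L` over `U`: multiplication by `e` is an isomorphism `𝒪_U ≅ L|_U`. -/
def IsFrame (L : X.Modules) (U : X.Opens) (e : Γ(L, U)) : Prop :=
  ∀ (V : X.Opens) (h : V ≤ U),
    Function.Bijective (fun a : Γ(X, V) => (a • resSection L h e : Γ(L, V)))

/-- `L` is a line bundle (invertible sheaf): it is locally isomorphic to `𝒪_X`. -/
def IsLineBundle (L : X.Modules) : Prop :=
  ∀ x : X, ∃ (U : X.Opens) (_ : x ∈ U) (e : Γ(L, U)), IsFrame L U e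

/-- The global section `u` of the line bundle `L` vanishes at the point `x`: writing `u = a • e`
in terms of a local frame `e` around `x`, the function `a` lies in the maximal ideal of
`𝒪_{X,x}` (`X.basicOpen a` is the set of points where `a` is a unit). -/
def VanishesAt (L : X.Modules) (u : Γ(L, ⊤)) (x : X) : Prop :=
  ∀ (U : X.Opens) (_ : x ∈ U) (e : Γ(L, U)), IsFrame L U e →
    ∀ a : Γ(X, U), resSection L le_top u = a • e → x ∉ X.basicOpen a

end LineBundles

/-- The space of global sections `Γ(X, L)`. -/
def GlobalSections (X : ProjectiveVariety) (L : X.scheme.Modules) : Type :=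
  Γ(L, (⊤ : X.scheme.Opens))

instance (X : ProjectiveVariety) (L : X.scheme.Modules) : AddCommGroup (GlobalSections X L) :=
  inferInstanceAs (AddCommGroup Γ(L, (⊤ : X.scheme.Opens)))

/-- `Γ(X, L)` as a complex vector space, through `ℂ → Γ(X, 𝒪_X)`. -/
instance (X : ProjectiveVariety) (L : X.scheme.Modules) : Module ℂ (GlobalSections X L) :=
  letI : Module Γ(X.scheme, ⊤) (GlobalSections X L) :=
    inferInstanceAs (Module Γ(X.scheme, ⊤) Γ(L, (⊤ : X.scheme.Opens)))
  Module.compHom (GlobalSections X L)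
    ((Scheme.ΓSpecIso (.of ℂ)).inv ≫ X.hom.appTop).hom

/-! ### The degree of a line bundle on a curve -/

section Degree

variable {C X : Scheme.{0}}

lemma genericPoint_mem_preimage [IsIntegral C] (i : C ⟶ X) {U : X.Opens} {z : C}
    (hz : i z ∈ U) : genericPoint C ∈ i ⁻¹ᵁ U :=
  (genericPoint_specializes z).mem_open (i ⁻¹ᵁ U).isOpen hz

/-- A nonzero rational section of the pullback of a line bundle `L` along `i : C ⟶ X`.
It is given by its coefficient in the function field of `C` with respect to every local frame of
`L` whose domain meets `C`; if `e = a • f` for two frames, then the coefficient with respect to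
`f` is the pullback of `a` times the coefficient with respect to `e`. -/
structure RationalSection [IsIntegral C] (i : C ⟶ X) (L : X.Modules) where
  /-- The coefficient of the section with respect to a frame. -/
  coeff (U : X.Opens) (e : Γ(L, U)) (he : IsFrame L U e) (hU : genericPoint C ∈ i ⁻¹ᵁ U) :
    C.functionField
  coeff_ne_zero (U : X.Opens) (e : Γ(L, U)) (he : IsFrame L U e)
    (hU : genericPoint C ∈ i ⁻¹ᵁ U) : coeff U e he hU ≠ 0
  coeff_change (U V : X.Opens) (e : Γ(L, U)) (f : Γ(L, V)) (he : IsFrame L U e)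
    (hf : IsFrame L V f) (hU : genericPoint C ∈ i ⁻¹ᵁ U) (hV : genericPoint C ∈ i ⁻¹ᵁ V)
    (a : Γ(X, U ⊓ V))
    (ha : resSection L (inf_le_left : U ⊓ V ≤ U) e =
      a • resSection L (inf_le_right : U ⊓ V ≤ V) f) :
    coeff V f hf hV =
      C.presheaf.germ (i ⁻¹ᵁ (U ⊓ V)) (genericPoint C) ⟨hU, hV⟩ (i.app (U ⊓ V) a) *
        coeff U e he hU

/-- `D` is the divisor of the rational section `s` on the curve `C`: its coefficient at `z` is the
order of vanishing at `z` of the coefficient of `s` with respect to any frame around `z`. -/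
def IsDivisorOf [IsIntegral C] [IsLocallyNoetherian C] {i : C ⟶ X} {L : X.Modules}
    (s : RationalSection i L) (D : C →₀ ℤ) : Prop :=
  ∀ (z : C) (U : X.Opens) (hz : i z ∈ U) (e : Γ(L, U)) (he : IsFrame L U e),
    D z = C.ord (s.coeff U e he (genericPoint_mem_preimage i hz)) z

/-- `t = ⟨c₁(L), C⟩` for a complete curve `i : C ⟶ X` over an algebraically closed field: `t` is
the degree of the divisor of a nonzero rational section of `L|_C`. (All closed points of `C` have
degree one. The order of vanishing at the generic point is `0`.) -/
def IsDegree [IsIntegral C] [IsLocallyNoetherian C] (i : C ⟶ X) (L : X.Modules) (t : ℤ) : Prop :=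
  ∃ (s : RationalSection i L) (D : C →₀ ℤ), IsDivisorOf s D ∧ t = D.sum fun _ m => m

end Degree

/-! ### Cusps, semigroups and the function `R` -/

section Cusps

variable (C : Scheme.{0}) [IsIntegral C]

/-- `z` is a singular point of `C`. -/
def IsSingularPoint (z : C) : Prop := ¬ IsRegularLocalRing (C.presheaf.stalk z)

/-- `C` is locally irreducible (has exactly one branch) at `z`: the integral closure of `𝒪_{C,z}`
in the function field has exactly one maximal ideal, that is, exactly one point of the
normalization lies over `z`. -/
def IsLocallyIrreducibleAt (z : C) : Prop :=
  IsLocalRing (integralClosure (C.presheaf.stalk z) C.functionField)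

/-- All singular points of `C` are cusps. -/
def IsCuspidal : Prop := ∀ z : C, IsSingularPoint C z → IsLocallyIrreducibleAt C z

variable {C} in
/-- The semigroup of the curve `C` at `z`: the set of intersection multiplicities
`length (𝒪_{C,z} / f)` at `z` of `C` with the curve germs `f = 0` that do not contain `C`. -/
def pointSemigroup (z : C) : AddSubmonoid ℕ where
  carrier := {m | ∃ f : C.presheaf.stalk z, f ≠ 0 ∧ Ring.ord (C.presheaf.stalk z) f = (m : ℕ∞)}
  zero_mem' := ⟨1, one_ne_zero, by simp⟩
  add_mem' := by
    rintro m n ⟨f, hf, hm⟩ ⟨g, hg, hn⟩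
    refine ⟨f * g, mul_ne_zero hf hg, ?_⟩
    rw [Ring.ord_mul _ (mem_nonZeroDivisors_of_ne_zero hg), hm, hn]
    push_cast
    rfl

end Cusps

/-- `R_S(t) = #(S ∩ [0, t))`. -/
def semigroupCount (S : AddSubmonoid ℕ) (t : ℤ) : ℤ :=
  (Set.ncard {m : ℕ | m ∈ S ∧ (m : ℤ) < t} : ℤ)

/-- The infimum convolution `(R₁ ⋄ R₂)(t) = min_k (R₁(k) + R₂(t - k))` of functions that are
bounded from below. -/
def infConvolution (R₁ R₂ : ℤ → ℤ) (t : ℤ) : ℤ := ⨅ k : ℤ, (R₁ k + R₂ (t - k))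

/-- `R_{S₁} ⋄ … ⋄ R_{Sₙ}`. For `n = 0` this is the counting function `t ↦ max(t, 0)` of the
semigroup `ℕ` of a smooth point, which is neutral for `⋄` on counting functions of semigroups. -/
def countingFunction : List (AddSubmonoid ℕ) → ℤ → ℤ
  | [] => semigroupCount ⊤
  | [S] => semigroupCount S
  | S :: T :: l => infConvolution (semigroupCount S) (countingFunction (T :: l))

end

/-! The proof plays a dimension count against a degree bound. Fix a nonzero rational section `s` of
`L|_C` whose divisor `D` has degree `t`. Dividing the restriction of a global section `u` by `s`
gives a rational function on `C` (`sectionQuotient`), nonzero for `u ≠ 0` because no nonzero section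
vanishes along `C`. Its order at `z` plus `D z` is the order of `u|_C` at `z`, that is, the length
of `𝒪_{C,z}` modulo a local equation of `u`, hence an element of the semigroup of `z`
(`isOrderFunction_ord_sectionQuotient`).

At a unibranch point this order is a discrete valuation with residue field `ℂ`, so two sections of
equal order agree to higher order up to a constant. The filtration by order thus drops by at most
one dimension at each element of `S_z` and nowhere else: having order at least `m` costs at most
`R_S(m)` conditions (`IsOrderFunction.finrank_le`). If a finite-dimensional space of sections had
dimension above `R(t+1)`, some splitting `t + 1 = m₁ + … + mₙ` would cost fewer conditions than the
dimension and leave a nonzero `u` of total order at least `t + 1`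
(`exists_le_sum_of_countingFunction_lt`). But the divisor of `u|_C` is effective of degree `t`
(`sum_ord_sectionQuotient_le`).

Rationality makes both the local structure and the degree formula explicit. The function field is
`ℂ(T)`; at a unibranch point some `S = 1/(T - c)` is integral, and the normalization is the
localization of `ℂ[S]` at some `S - a`. It is finite over the local ring, so orders may be computed
in it (`ord_eq_relLength`). The valuative criterion puts exactly one point of `C` under each point
of `ℙ¹` (`exists_unique_isPlaceAt`). So each `T - b` has one simple zero and one simple pole; with
the constants these functions generate `ℂ(T)ˣ`, and principal divisors have degree zero
(`exists_principalDivisor`). -/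

noncomputable section

/-! ### Unibranch local rings of rational function fields -/

section Unibranch

open Polynomial IntermediateField

variable {k K R : Type*} [Field k] [Field K] [Algebra k K]
  [CommRing R] [Algebra R K] [Algebra k R] [IsScalarTower k R K]

lemma algebraMap_mem_of_isScalarTower (B : Subalgebra R K) (c : k) : algebraMap k K c ∈ B := by
  rw [IsScalarTower.algebraMap_apply k R K]
  exact B.algebraMap_mem _

lemma aeval_mem_of_isScalarTower (B : Subalgebra R K) {S : K} (hS : S ∈ B) (p : k[X]) :
    aeval S p ∈ B := by
  rw [aeval_eq_sum_range]
  refine sum_mem fun i _ => ?_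
  rw [Algebra.smul_def]
  exact mul_mem (algebraMap_mem_of_isScalarTower B _) (pow_mem hS _)

lemma aeval_eq_eval_add_mul_divX (S : K) (a : k) (p : k[X]) :
    ∃ q : k[X], aeval S p = algebraMap k K (p.eval a) + (S - algebraMap k K a) * aeval S q := by
  obtain ⟨q, hq⟩ := X_sub_C_dvd_sub_C_eval (a := a) (p := p)
  refine ⟨q, ?_⟩
  have := congrArg (aeval S) hq
  simp only [map_sub, map_mul, aeval_C, aeval_X] at this
  rw [← this]; ring

/-- If `R` is not a field, then all but finitely many of the coordinates `1 / (T - c)` on the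
rational function field `k(T)` are integral over the unibranch local ring `R`. -/
lemma exists_inv_sub_mem_integralClosure [Infinite k] [IsLocalRing R] [IsDomain R]
    [IsFractionRing R K] [IsLocalRing (integralClosure R K)]
    (hR : ¬ IsField R) {T : K} (hT : k⟮T⟯ = ⊤) :
    ∃ c : k, (T - algebraMap k K c)⁻¹ ∈ integralClosure R K := by
  obtain ⟨f, hf, hf0⟩ : ∃ f ∈ IsLocalRing.maximalIdeal R, f ≠ 0 :=
    Submodule.exists_mem_ne_zero_of_ne_bot fun h =>
      hR (IsLocalRing.isField_iff_maximalIdeal_eq.mpr h)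
  have hf0' : algebraMap R K f ≠ 0 := by simpa using hf0
  obtain ⟨p, q, hpq⟩ := (mem_adjoin_simple_iff k (algebraMap R K f)).mp (by rw [hT]; trivial)
  have hp : p ≠ 0 := by rintro rfl; simp at hpq; exact hf0 hpq
  have hq : aeval T q ≠ 0 := by intro h; simp [h] at hpq; exact hf0 hpq
  -- With `f = p(T)/q(T)`, any `c` off the finitely many roots of the numerator will do.
  obtain ⟨c, hc⟩ : ∃ c, p.eval c ≠ 0 := by
    by_contra! h
    exact hp (Polynomial.funext fun x => by simpa using h x)
  refine ⟨c, ?_⟩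
  by_contra hS
  let A : LocalSubring K :=
    { toSubring := (integralClosure R K).toSubring
      isLocalRing := ‹IsLocalRing (integralClosure R K)› }
  have : IsIntegrallyClosedIn A.toSubring K :=
    inferInstanceAs (IsIntegrallyClosedIn (integralClosure R K) K)
  -- A valuation ring `W` dominating the normalization and omitting `1/(T - c)` has `T - c` and `f`
  -- in its maximal ideal. Then `p(T) = f q(T)` is there too, and so is the nonzero constant `p(c)`,
  -- which is absurd.
  obtain ⟨W, ⟨hW, hWloc⟩, hSW⟩ :=
    LocalSubring.exists_le_valuationSubring_of_isIntegrallyClosedIn (R := A) hS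
  have hkW (c : k) : algebraMap k K c ∈ W := hW (algebraMap_mem_of_isScalarTower _ c)
  set y := T - algebraMap k K c with hy
  have hyW : W.valuation y < 1 := by
    have := (W.inv_mem_nonunits_iff (x := y⁻¹)).mpr (Or.inr hSW)
    rwa [inv_inv] at this
  have hTW : T ∈ W := by
    have h := W.add_mem _ _ ((W.valuation_le_one_iff _).mp hyW.le) (hkW c)
    rwa [hy, sub_add_cancel] at h
  have hpolW (g : k[X]) : W.valuation (aeval T g) ≤ 1 := by
    rw [W.valuation_le_one_iff]
    rw [aeval_eq_sum_range]
    refine sum_mem fun i _ => ?_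
    rw [Algebra.smul_def]
    exact mul_mem (hkW _) (pow_mem hTW _)
  have hfW : W.valuation (algebraMap R K f) < 1 := by
    by_contra h
    have hfm : algebraMap R K f ∈ W := hW (Subalgebra.algebraMap_mem _ _)
    have hfu : IsUnit (⟨algebraMap R K f, hfm⟩ : W) :=
      (W.valuation_eq_one_iff ⟨_, hfm⟩).mpr
        (le_antisymm ((W.valuation_le_one_iff _).mpr hfm) (not_lt.mp h))
    have hfA : IsUnit (algebraMap R (integralClosure R K) f) :=
      hWloc.map_nonunit (algebraMap R (integralClosure R K) f) hfu
    exact hf ((isUnit_map_iff _ _).mp hfA)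
  have hpT : W.valuation (aeval T p) < 1 := by
    have : aeval T p = algebraMap R K f * aeval T q := by rw [hpq, div_mul_cancel₀ _ hq]
    rw [this, map_mul]
    exact mul_lt_one_of_lt_of_le hfW (hpolW q)
  obtain ⟨p₁, hp₁⟩ := aeval_eq_eval_add_mul_divX T c p
  have h1 : algebraMap k K (p.eval c) = aeval T p - y * aeval T p₁ := by rw [hp₁]; ring
  have h2 : W.valuation (algebraMap k K (p.eval c)) < 1 := by
    rw [h1]
    refine (Valuation.map_sub _ _ _).trans_lt (max_lt hpT ?_)
    rw [map_mul]
    exact mul_lt_one_of_lt_of_le hyW (hpolW _)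
  rw [← W.mem_nonunits_iff, W.mem_nonunits_iff_or] at h2
  rcases h2 with h2 | h2
  · simp at h2; exact hc h2
  · rw [← map_inv₀] at h2; exact h2 (hkW _)

variable (k) in
/-- `π` is a uniformizer of the unibranch local ring `R` of a curve over the algebraically closed
field `k`: a generator of the maximal ideal of the normalization, which has residue field `k`. -/
structure IsBranchUniformizer (R : Type*) {K : Type*} [Field K] [Algebra k K]
    [CommRing R] [Algebra R K] (π : K) : Prop where
  mem : π ∈ integralClosure R K
  ne_zero : π ≠ 0
  inv_notMem : π⁻¹ ∉ integralClosure R K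
  exists_eq_zpow_mul (x : K) (hx : x ≠ 0) : ∃ (n : ℤ) (u : K),
    u ∈ integralClosure R K ∧ u⁻¹ ∈ integralClosure R K ∧ x = π ^ n * u
  exists_sub_mem (x : K) (hx : x ∈ integralClosure R K) :
    ∃ c : k, ∃ y ∈ integralClosure R K, x = algebraMap k K c + π * y

/-- In a local ring `integralClosure R K` in which `S - a` is not a unit, the value of a polynomial
at `S` is a unit if the polynomial does not vanish at `a`. -/
lemma inv_aeval_mem_integralClosure [IsLocalRing (integralClosure R K)] {S : K} {a : k}
    (hS : S ∈ integralClosure R K) (ha : (S - algebraMap k K a)⁻¹ ∉ integralClosure R K)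
    {p : k[X]} (hp : p.eval a ≠ 0) :
    aeval S p ≠ 0 ∧ (aeval S p)⁻¹ ∈ integralClosure R K := by
  obtain ⟨q, hq⟩ := aeval_eq_eval_add_mul_divX S a p
  have hmem (c : k) : algebraMap k K c ∈ integralClosure R K := algebraMap_mem_of_isScalarTower _ c
  let V := integralClosure R K
  let π : V := ⟨S - algebraMap k K a, sub_mem hS (hmem _)⟩
  have hπ : ¬ IsUnit π := by
    intro h
    obtain ⟨y, hy⟩ := h.exists_right_inv
    apply ha
    have : (S - algebraMap k K a) * y = 1 := congrArg Subtype.val hy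
    rw [← eq_inv_of_mul_eq_one_right this]
    exact y.2
  let x : V := ⟨aeval S p, aeval_mem_of_isScalarTower _ hS p⟩
  let y : V := ⟨aeval S q, aeval_mem_of_isScalarTower _ hS q⟩
  let c : V := ⟨algebraMap k K (p.eval a), hmem _⟩
  have hc : IsUnit c := .of_mul_eq_one ⟨algebraMap k K (p.eval a)⁻¹, hmem _⟩
    (Subtype.ext (by simp [c, hp]))
  have hx : IsUnit x := by
    by_contra h
    have h1 : c = x - π * y := Subtype.ext (by simp [c, x, π, y, hq])
    have h2 : x ∈ IsLocalRing.maximalIdeal V := h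
    have h3 : π * y ∈ IsLocalRing.maximalIdeal V := Ideal.mul_mem_right _ _ hπ
    exact (IsLocalRing.mem_maximalIdeal c).mp (h1 ▸ sub_mem h2 h3) hc
  obtain ⟨z, hz⟩ := hx.exists_right_inv
  have hz' : aeval S p * z = 1 := congrArg Subtype.val hz
  exact ⟨left_ne_zero_of_mul_eq_one hz', by rw [← eq_inv_of_mul_eq_one_right hz']; exact z.2⟩

/-- Otherwise every nonzero `S - a` is invertible in the normalization. Polynomials over `k` split,
so all nonzero polynomials in `S` are invertible there. Then all of `K` is integral over `R`, which
forces `R` to be a field. -/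
lemma exists_inv_sub_notMem_integralClosure [IsAlgClosed k] [IsDomain R] [IsFractionRing R K]
    (hR : ¬ IsField R) {S : K} (hS : k⟮S⟯ = ⊤) (hSmem : S ∈ integralClosure R K) :
    ∃ a : k, (S - algebraMap k K a) ≠ 0 ∧ (S - algebraMap k K a)⁻¹ ∉ integralClosure R K := by
  by_contra! h
  have key (q : k[X]) : (aeval S q)⁻¹ ∈ integralClosure R K := by
    rw [(IsAlgClosed.splits q).eq_prod_roots]
    simp only [map_mul, mul_inv, aeval_C, ← map_inv₀]
    refine mul_mem (algebraMap_mem_of_isScalarTower _ _) ?_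
    rw [map_multiset_prod, ← Multiset.prod_map_inv', Multiset.map_map, Multiset.map_map]
    refine multiset_prod_mem _ fun x hx => ?_
    obtain ⟨b, -, rfl⟩ := Multiset.mem_map.mp hx
    simp only [Function.comp_apply, map_sub, aeval_X, aeval_C]
    by_cases hb : S - algebraMap k K b = 0
    · simp [hb]
    · exact h b hb
  have : Algebra.IsIntegral R K := ⟨fun x => by
    obtain ⟨p, q, rfl⟩ := (mem_adjoin_simple_iff k x).mp (by rw [hS]; trivial)
    rw [div_eq_mul_inv]
    exact (integralClosure R K).mul_mem (aeval_mem_of_isScalarTower _ hSmem p) (key q)⟩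
  exact hR (isField_of_isIntegral_of_isField (IsFractionRing.injective R K)
    (Semifield.toIsField K))

lemma exists_eq_zpow_mul_aeval_div {S : K} (hS : k⟮S⟯ = ⊤) {a : k}
    (ha0 : S - algebraMap k K a ≠ 0) {x : K} (hx : x ≠ 0) :
    ∃ (n : ℤ) (p q : k[X]), p.eval a ≠ 0 ∧ q.eval a ≠ 0 ∧
      x = (S - algebraMap k K a) ^ n * (aeval S p / aeval S q) := by
  obtain ⟨p, q, rfl⟩ := (mem_adjoin_simple_iff k x).mp (by rw [hS]; trivial)
  have hp0 : p ≠ 0 := by rintro rfl; simp at hx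
  have hq0 : q ≠ 0 := by rintro rfl; simp at hx
  obtain ⟨p', hp', hpd⟩ := exists_eq_pow_rootMultiplicity_mul_and_not_dvd p hp0 a
  obtain ⟨q', hq', hqd⟩ := exists_eq_pow_rootMultiplicity_mul_and_not_dvd q hq0 a
  refine ⟨(p.rootMultiplicity a : ℤ) - q.rootMultiplicity a, p', q', ?_, ?_, ?_⟩
  · rwa [dvd_iff_isRoot] at hpd
  · rwa [dvd_iff_isRoot] at hqd
  · conv_lhs => rw [hp', hq']
    rw [zpow_sub₀ ha0, zpow_natCast, zpow_natCast]
    simp only [map_mul, map_pow, map_sub, aeval_X, aeval_C]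
    ring

/-- The normalization of `R` is the localization of `k[S]` at `S - a`. -/
lemma exists_eq_aeval_div_of_mem_integralClosure [IsLocalRing (integralClosure R K)] {S : K}
    (hS : k⟮S⟯ = ⊤) (hSmem : S ∈ integralClosure R K) {a : k} (ha0 : S - algebraMap k K a ≠ 0)
    (ha : (S - algebraMap k K a)⁻¹ ∉ integralClosure R K) {x : K}
    (hx : x ∈ integralClosure R K) :
    ∃ p q : k[X], q.eval a ≠ 0 ∧ x = aeval S p / aeval S q := by
  by_cases hx0 : x = 0
  · exact ⟨0, 1, by simp, by simp [hx0]⟩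
  obtain ⟨n, p, q, hp, hq, hxe⟩ := exists_eq_zpow_mul_aeval_div hS ha0 hx0
  obtain ⟨hp0, hpi⟩ := inv_aeval_mem_integralClosure hSmem ha hp
  obtain ⟨hq0, hqi⟩ := inv_aeval_mem_integralClosure hSmem ha hq
  have hπ := sub_mem hSmem (algebraMap_mem_of_isScalarTower (integralClosure R K) a)
  -- A negative exponent would make `(S - a)⁻¹` integral, since the factor `p(S)/q(S)` is a unit of
  -- the normalization.
  rcases lt_or_ge n 0 with hn | hn
  · exfalso
    obtain ⟨m, rfl⟩ : ∃ m : ℕ, n = -(m + 1 : ℤ) := ⟨(-n - 1).toNat, by omega⟩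
    apply ha
    have : (S - algebraMap k K a)⁻¹ = (S - algebraMap k K a) ^ m * x *
        (aeval S q * (aeval S p)⁻¹) := by
      rw [hxe, zpow_neg, zpow_add₀ ha0, zpow_natCast]
      field_simp
    rw [this]
    exact mul_mem (mul_mem (pow_mem hπ m) hx) (mul_mem (aeval_mem_of_isScalarTower _ hSmem q) hpi)
  · lift n to ℕ using hn
    refine ⟨(X - C a) ^ n * p, q, hq, ?_⟩
    rw [hxe, zpow_natCast]
    simp only [map_mul, map_pow, map_sub, aeval_X, aeval_C]
    ring

lemma isBranchUniformizer_sub_of_mem [IsLocalRing (integralClosure R K)] {S : K} (hS : k⟮S⟯ = ⊤)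
    (hSmem : S ∈ integralClosure R K) {a : k} (ha0 : S - algebraMap k K a ≠ 0)
    (ha : (S - algebraMap k K a)⁻¹ ∉ integralClosure R K) :
    IsBranchUniformizer k R (S - algebraMap k K a) := by
  refine ⟨sub_mem hSmem (algebraMap_mem_of_isScalarTower _ a), ha0, ha, fun x hx => ?_,
    fun x hx => ?_⟩
  · obtain ⟨n, p, q, hp, hq, rfl⟩ := exists_eq_zpow_mul_aeval_div hS ha0 hx
    refine ⟨n, _, ?_, ?_, rfl⟩
    · rw [div_eq_mul_inv]
      exact mul_mem (aeval_mem_of_isScalarTower _ hSmem p)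
        (inv_aeval_mem_integralClosure hSmem ha hq).2
    · rw [inv_div, div_eq_mul_inv]
      exact mul_mem (aeval_mem_of_isScalarTower _ hSmem q)
        (inv_aeval_mem_integralClosure hSmem ha hp).2
  · obtain ⟨p, q, hq, rfl⟩ := exists_eq_aeval_div_of_mem_integralClosure hS hSmem ha0 ha hx
    obtain ⟨hq0, hqi⟩ := inv_aeval_mem_integralClosure hSmem ha hq
    -- The residue of `p(S)/q(S)` is `p(a)/q(a)`; subtracting it leaves a numerator vanishing at
    -- `a`, hence divisible by `S - a`.
    obtain ⟨p', hp'⟩ := aeval_eq_eval_add_mul_divX S a (p - C (p.eval a / q.eval a) * q)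
    refine ⟨p.eval a / q.eval a, aeval S p' * (aeval S q)⁻¹,
      mul_mem (aeval_mem_of_isScalarTower _ hSmem p') hqi, ?_⟩
    simp only [map_sub, map_mul, aeval_C, eval_sub, eval_mul, eval_C,
      div_mul_cancel₀ _ hq, sub_self, map_zero, zero_add] at hp'
    rw [← mul_assoc, ← hp']
    field_simp
    ring

/-- The normalization of a unibranch local ring `R` of `k(S)` with integral coordinate `S` is
`R[S]`; in particular it is a finite `R`-module. -/
lemma fg_integralClosure_of_mem [IsLocalRing (integralClosure R K)] {S : K} (hS : k⟮S⟯ = ⊤)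
    (hSmem : S ∈ integralClosure R K) {a : k} (ha0 : S - algebraMap k K a ≠ 0)
    (ha : (S - algebraMap k K a)⁻¹ ∉ integralClosure R K) :
    (Subalgebra.toSubmodule (integralClosure R K)).FG := by
  suffices h : integralClosure R K = Algebra.adjoin R {S} by
    rw [h]; exact IsIntegral.fg_adjoin_singleton hSmem
  have hle : Algebra.adjoin R {S} ≤ integralClosure R K := Algebra.adjoin_le (by simpa using hSmem)
  have hSadj : S ∈ Algebra.adjoin R {S} := Algebra.self_mem_adjoin_singleton R S
  refine le_antisymm (fun x hx => ?_) hle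
  obtain ⟨p, q, hq, rfl⟩ := exists_eq_aeval_div_of_mem_integralClosure hS hSmem ha0 ha hx
  obtain ⟨hq0, hqi⟩ := inv_aeval_mem_integralClosure hSmem ha hq
  rw [div_eq_mul_inv]
  refine mul_mem (aeval_mem_of_isScalarTower _ hSadj p) ?_
  -- The normalization is integral over `R[S]`, so an element of `R[S]` that is a unit upstairs is
  -- already a unit in `R[S]`. This supplies the denominators.
  have hincl : (Subalgebra.inclusion hle).toRingHom.IsIntegral := by
    intro y
    have h := IsIntegral.tower_top (A := Algebra.adjoin R {S}) (show IsIntegral R (y : K) from y.2)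
    obtain ⟨g, hg, hg0⟩ := h
    refine ⟨g, hg, Subtype.ext ?_⟩
    exact (hom_eval₂ g _ (integralClosure R K).val.toRingHom y).trans hg0
  have hloc := hincl.isLocalHom (Subalgebra.inclusion_injective hle)
  have hu : IsUnit (⟨aeval S q, aeval_mem_of_isScalarTower _ hSadj q⟩ : Algebra.adjoin R {S}) := by
    refine hloc.map_nonunit _ (.of_mul_eq_one ⟨(aeval S q)⁻¹, hqi⟩ (Subtype.ext ?_))
    exact mul_inv_cancel₀ hq0
  obtain ⟨z, hz⟩ := hu.exists_right_inv
  have hz' : aeval S q * z = 1 := congrArg Subtype.val hz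
  rw [← eq_inv_of_mul_eq_one_right hz']
  exact z.2

end Unibranch

/-! ### Relative length of submodules -/

section RelativeLength

variable {R M : Type*} [CommRing R] [AddCommGroup M] [Module R M]

/-- The length of `A / B` for submodules `B ≤ A`. -/
def relLength (A B : Submodule R M) : ℕ∞ := Module.length R (A ⧸ B.submoduleOf A)

lemma relLength_add {A B C : Submodule R M} (hBA : B ≤ A) (hCB : C ≤ B) :
    relLength A C = relLength B C + relLength A B := by
  have h₁ : C.submoduleOf B ≤ (C.submoduleOf A).comap (Submodule.inclusion hBA) :=
    fun x hx => hx
  have h₂ : C.submoduleOf A ≤ B.submoduleOf A := fun x hx => hCB hx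
  refine Module.length_eq_add_of_exact
    (Submodule.mapQ (C.submoduleOf B) (C.submoduleOf A) (Submodule.inclusion hBA) h₁)
    (Submodule.factor h₂) ?_ (Submodule.factor_surjective h₂) ?_
  · rw [← LinearMap.ker_eq_bot, eq_bot_iff]
    intro x hx
    obtain ⟨x, rfl⟩ := Submodule.Quotient.mk_surjective _ x
    rw [LinearMap.mem_ker, Submodule.mapQ_apply, Submodule.Quotient.mk_eq_zero] at hx
    exact (Submodule.Quotient.mk_eq_zero _).mpr hx
  · intro y
    obtain ⟨y, rfl⟩ := Submodule.Quotient.mk_surjective _ y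
    constructor
    · intro h
      have h' : (y : M) ∈ B := (Submodule.Quotient.mk_eq_zero (B.submoduleOf A)).mp h
      exact ⟨Submodule.Quotient.mk ⟨y, h'⟩, rfl⟩
    · rintro ⟨x, hx⟩
      obtain ⟨x, rfl⟩ := Submodule.Quotient.mk_surjective _ x
      rw [← hx]
      exact (Submodule.Quotient.mk_eq_zero (B.submoduleOf A)).mpr x.2

lemma relLength_map_equiv (e : M ≃ₗ[R] M) (A B : Submodule R M) :
    relLength (A.map (e : M →ₗ[R] M)) (B.map (e : M →ₗ[R] M)) = relLength A B := by
  refine (LinearEquiv.length_eq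
    (Submodule.Quotient.equiv (B.submoduleOf A) _ (e.submoduleMap A) ?_)).symm
  ext ⟨x, hx⟩
  obtain ⟨y, hy, rfl⟩ := hx
  simp [Submodule.submoduleOf]

/-- A finitely generated torsion module over a one-dimensional Noetherian domain has finite
length. -/
lemma isFiniteLength_of_smul_eq_zero [IsDomain R] [IsNoetherianRing R] [Ring.KrullDimLE 1 R]
    [Module.Finite R M] {d : R} (hd : d ≠ 0) (h : ∀ x : M, d • x = 0) : IsFiniteLength R M := by
  have hR := isFiniteLength_quotient_span_singleton R (mem_nonZeroDivisors_of_ne_zero hd)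
  rw [isFiniteLength_iff_isNoetherian_isArtinian] at hR ⊢
  obtain ⟨_, _⟩ := hR
  refine ⟨inferInstance, ?_⟩
  obtain ⟨s, hs⟩ := (Module.Finite.fg_top : (⊤ : Submodule R M).FG)
  have hx (x : M) : IsArtinian R (Submodule.span R {x}) := by
    rw [LinearMap.span_singleton_eq_range]
    have hker : Ideal.span {d} ≤ LinearMap.ker (LinearMap.toSpanSingleton R M x) := by
      rw [Ideal.span_singleton_le_iff_mem]; simpa using h x
    rw [← Submodule.range_liftQ (Ideal.span {d}) _ hker]
    infer_instance
  have : IsArtinian R (⊤ : Submodule R M) := by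
    rw [← hs, Submodule.span_eq_iSup_of_singleton_spans, iSup_subtype']
    exact isArtinian_iSup
  exact isArtinian_of_linearEquiv Submodule.topEquiv

end RelativeLength

/-! ### Orders of vanishing computed in the normalization -/

section OrdFrac

variable {R K : Type*} [CommRing R] [Field K] [Algebra R K]

/-- Multiplication by a nonzero element of a field. -/
def mulEquivOfNeZero (R : Type*) {K : Type*} [CommRing R] [Field K] [Algebra R K]
    {x : K} (hx : x ≠ 0) : K ≃ₗ[R] K :=
  LinearEquiv.ofBijective (LinearMap.mulLeft R x)
    ⟨mul_right_injective₀ hx, fun y => ⟨x⁻¹ * y, mul_inv_cancel_left₀ hx y⟩⟩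

variable [IsDomain R] [IsNoetherianRing R] [Ring.KrullDimLE 1 R] [IsFractionRing R K]

/-- A common denominator of finitely many generators kills the quotient, which is thus finitely
generated and torsion over a one-dimensional Noetherian domain. Finiteness permits cancelling this
length in `ord_eq_relLength`. -/
lemma relLength_integralClosure_ne_top
    (hfg : (Subalgebra.toSubmodule (integralClosure R K)).FG) :
    relLength (Subalgebra.toSubmodule (integralClosure R K)) 1 ≠ ⊤ := by
  have hfin : Module.Finite R (Subalgebra.toSubmodule (integralClosure R K)) :=
    Module.Finite.iff_fg.mpr hfg
  obtain ⟨s, hs⟩ := hfg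
  obtain ⟨d, hd⟩ := IsLocalization.exist_integer_multiples_of_finset (nonZeroDivisors R) s
  rw [relLength, Module.length_ne_top_iff]
  refine isFiniteLength_of_smul_eq_zero (nonZeroDivisors.coe_ne_zero d) fun x => ?_
  obtain ⟨x, rfl⟩ := Submodule.Quotient.mk_surjective _ x
  rw [← Submodule.Quotient.mk_smul, Submodule.Quotient.mk_eq_zero]
  obtain ⟨x, hx⟩ := x
  change (d : R) • x ∈ (1 : Submodule R K)
  rw [← hs] at hx
  induction hx using Submodule.span_induction with
  | mem y hy =>
    obtain ⟨r, hr⟩ := hd y hy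
    exact Submodule.mem_one.mpr ⟨r, hr⟩
  | zero => simp
  | add y z _ _ hy hz => rw [smul_add]; exact add_mem hy hz
  | smul r y _ hy => rw [smul_comm]; exact Submodule.smul_mem _ _ hy

/-- Let `V` be the normalization. The length of `V / rR` is computed through `R` and through `rV`;
multiplication by `r` identifies `V/R` with `rV/rR`, and the two finite equal terms cancel. -/
lemma ord_eq_relLength (hfg : (Subalgebra.toSubmodule (integralClosure R K)).FG)
    {r : R} (hr : algebraMap R K r ≠ 0) :
    Ring.ord R r = relLength (Subalgebra.toSubmodule (integralClosure R K))
      ((Subalgebra.toSubmodule (integralClosure R K)).map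
        (mulEquivOfNeZero R hr : K →ₗ[R] K)) := by
  set V := Subalgebra.toSubmodule (integralClosure R K) with hV
  set e := mulEquivOfNeZero R hr
  have h1V : (1 : Submodule R K) ≤ V := by
    rintro _ h
    obtain ⟨s, rfl⟩ := Submodule.mem_one.mp h
    exact Subalgebra.algebraMap_mem _ s
  have hVV : V.map (e : K →ₗ[R] K) ≤ V := by
    rintro _ ⟨y, hy, rfl⟩
    exact (integralClosure R K).mul_mem (Subalgebra.algebraMap_mem _ r) hy
  have h11 : (1 : Submodule R K).map (e : K →ₗ[R] K) ≤ 1 := by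
    rintro _ ⟨y, hy, rfl⟩
    obtain ⟨s, rfl⟩ := Submodule.mem_one.mp hy
    exact Submodule.mem_one.mpr ⟨r * s, map_mul _ _ _⟩
  have hA := relLength_add h1V h11
  have hB := relLength_add hVV (Submodule.map_mono h1V)
  rw [relLength_map_equiv, hA, add_comm] at hB
  have hord : relLength 1 ((1 : Submodule R K).map (e : K →ₗ[R] K)) = Ring.ord R r := by
    let f : R ≃ₗ[R] (1 : Submodule R K) :=
      (LinearEquiv.ofInjective (Algebra.linearMap R K) (IsFractionRing.injective R K)).trans
        (LinearEquiv.ofEq _ _ Submodule.one_eq_range.symm)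
    refine (LinearEquiv.length_eq (Submodule.Quotient.equiv (Ideal.span {r}) _ f ?_)).symm
    ext ⟨y, hy⟩
    obtain ⟨s, rfl⟩ := Submodule.mem_one.mp hy
    rw [Submodule.mem_map]
    constructor
    · rintro ⟨a, ha, hax⟩
      obtain ⟨b, rfl⟩ := Ideal.mem_span_singleton'.mp ha
      have : algebraMap R K (b * r) = algebraMap R K s := congrArg Subtype.val hax
      refine ⟨algebraMap R K b, Submodule.mem_one.mpr ⟨b, rfl⟩, ?_⟩
      change algebraMap R K r * algebraMap R K b = algebraMap R K s
      rw [← this, map_mul, mul_comm]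
    · rintro ⟨a, ha, hax⟩
      obtain ⟨b, rfl⟩ := Submodule.mem_one.mp ha
      change algebraMap R K r * algebraMap R K b = algebraMap R K s at hax
      refine ⟨b * r, Ideal.mem_span_singleton'.mpr ⟨b, rfl⟩, Subtype.ext ?_⟩
      change algebraMap R K (b * r) = algebraMap R K s
      rw [← hax, map_mul, mul_comm]
  rw [hord] at hB
  exact ENat.add_right_injective_of_ne_top (relLength_integralClosure_ne_top hfg) hB

variable (R) in
/-- The colength of `x V` in the normalization `V` of `R`, for `x ≠ 0`. -/
def normalizationColength {x : K} (hx : x ≠ 0) : ℕ∞ :=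
  relLength (Subalgebra.toSubmodule (integralClosure R K))
    ((Subalgebra.toSubmodule (integralClosure R K)).map (mulEquivOfNeZero R hx : K →ₗ[R] K))

omit [IsDomain R] [IsNoetherianRing R] [Ring.KrullDimLE 1 R] [IsFractionRing R K] in
lemma map_mulEquivOfNeZero_integralClosure_le {x : K} (hx : x ≠ 0)
    (hxV : x ∈ integralClosure R K) :
    (Subalgebra.toSubmodule (integralClosure R K)).map (mulEquivOfNeZero R hx : K →ₗ[R] K) ≤
      Subalgebra.toSubmodule (integralClosure R K) := by
  rintro _ ⟨y, hy, rfl⟩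
  exact (integralClosure R K).mul_mem hxV hy

omit [IsDomain R] [IsNoetherianRing R] [Ring.KrullDimLE 1 R] [IsFractionRing R K] in
lemma normalizationColength_mul {x y : K} (hx : x ≠ 0) (hy : y ≠ 0)
    (hxV : x ∈ integralClosure R K) (hyV : y ∈ integralClosure R K) :
    normalizationColength R (mul_ne_zero hx hy) =
      normalizationColength R hy + normalizationColength R hx := by
  have h : (Subalgebra.toSubmodule (integralClosure R K)).map
      (mulEquivOfNeZero R (mul_ne_zero hx hy) : K →ₗ[R] K) =
      ((Subalgebra.toSubmodule (integralClosure R K)).map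
        (mulEquivOfNeZero R hy : K →ₗ[R] K)).map (mulEquivOfNeZero R hx : K →ₗ[R] K) := by
    rw [← Submodule.map_comp]
    congr 1
    ext z
    exact mul_assoc x y z
  unfold normalizationColength
  rw [h, relLength_add (map_mulEquivOfNeZero_integralClosure_le hx hxV)
    (Submodule.map_mono (map_mulEquivOfNeZero_integralClosure_le hy hyV)), relLength_map_equiv]

/-- For `x = r/s` with `r, s` in `R`, the identity `s x = r` and additivity of colengths reduce the
claim to elements of `R`, where `ord_eq_relLength` applies. -/
lemma ordFrac_eq_of_normalizationColength_eq
    (hfg : (Subalgebra.toSubmodule (integralClosure R K)).FG)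
    {x : K} (hx : x ≠ 0) (hxV : x ∈ integralClosure R K) {n : ℕ}
    (hn : normalizationColength R hx = n) :
    Ring.ordFrac R x = WithZero.exp (n : ℤ) := by
  obtain ⟨r, s, hs, rfl⟩ := IsFractionRing.div_surjective (A := R) x
  have hs0 : s ≠ 0 := nonZeroDivisors.ne_zero hs
  have hs' : algebraMap R K s ≠ 0 := by simpa using hs0
  have hr' : algebraMap R K r ≠ 0 := by
    intro h; simp [h] at hx
  have hr0 : r ≠ 0 := by rintro rfl; simp at hr'
  have hmul := normalizationColength_mul hs' hx (Subalgebra.algebraMap_mem _ s) hxV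
  have hr2 : normalizationColength R (mul_ne_zero hs' hx) = Ring.ord R r := by
    rw [ord_eq_relLength hfg hr']
    unfold normalizationColength
    congr! 4
    field_simp
  have hs2 : normalizationColength R hs' = Ring.ord R s := (ord_eq_relLength hfg hs').symm
  rw [hr2, hs2, hn] at hmul
  have hst := Ring.ord_ne_top (mem_nonZeroDivisors_of_ne_zero hs0)
  obtain ⟨m, hm⟩ := ENat.ne_top_iff_exists.mp hst
  rw [map_div₀, Ring.ordFrac_eq_ord R hr0, Ring.ordFrac_eq_ord R hs0,
    Ring.ordMonoidWithZeroHom_eq_coe R (mem_nonZeroDivisors_of_ne_zero hs0) hm.symm,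
    Ring.ordMonoidWithZeroHom_eq_coe R (mem_nonZeroDivisors_of_ne_zero hr0) (n := n + m)
      (by rw [hmul, ← hm]; norm_cast)]
  change WithZero.exp ((n + m : ℕ) : ℤ) / WithZero.exp (m : ℤ) = _
  rw [← WithZero.exp_sub]
  congr 1
  push_cast; ring

lemma ordFrac_eq_one_of_inv_mem (hfg : (Subalgebra.toSubmodule (integralClosure R K)).FG)
    {u : K} (hu : u ≠ 0) (huV : u ∈ integralClosure R K) (huV' : u⁻¹ ∈ integralClosure R K) :
    Ring.ordFrac R u = 1 := by
  refine (ordFrac_eq_of_normalizationColength_eq hfg hu huV (n := 0) ?_).trans (by simp)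
  rw [Nat.cast_zero, normalizationColength, relLength, Module.length_eq_zero_iff,
    Submodule.Quotient.subsingleton_iff, Submodule.submoduleOf_eq_top]
  intro y hy
  exact ⟨u⁻¹ * y, (integralClosure R K).mul_mem huV' hy, mul_inv_cancel_left₀ hu y⟩

variable {k : Type*} [Field k] [Algebra k K] [Algebra k R] [IsScalarTower k R K]

namespace IsBranchUniformizer

variable {π : K} (hπ : IsBranchUniformizer k R π)
include hπ

/-- The quotient of the normalization by `π` has only constants as classes, so each nonzero class
generates it: it is simple, of length one. -/
lemma ordFrac_self (hfg : (Subalgebra.toSubmodule (integralClosure R K)).FG) :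
    Ring.ordFrac R π = WithZero.exp 1 := by
  refine ordFrac_eq_of_normalizationColength_eq hfg hπ.ne_zero hπ.mem (n := 1) ?_
  rw [Nat.cast_one, normalizationColength, relLength, Module.length_eq_one_iff,
    isSimpleModule_iff_toSpanSingleton_surjective]
  have hone : (1 : K) ∉ (Subalgebra.toSubmodule (integralClosure R K)).map
      (mulEquivOfNeZero R hπ.ne_zero : K →ₗ[R] K) := by
    rintro ⟨y, hy, hy'⟩
    have hy' : π * y = 1 := hy'
    exact hπ.inv_notMem (by rw [← eq_inv_of_mul_eq_one_right hy']; exact hy)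
  constructor
  · rw [Submodule.Quotient.nontrivial_iff, Ne, Submodule.submoduleOf_eq_top]
    exact fun h => hone (h (integralClosure R K).one_mem)
  · intro x hx y
    obtain ⟨⟨x, hxV⟩, rfl⟩ := Submodule.Quotient.mk_surjective _ x
    obtain ⟨⟨y, hyV⟩, rfl⟩ := Submodule.Quotient.mk_surjective _ y
    obtain ⟨c, x', hx', hxe⟩ := hπ.exists_sub_mem x hxV
    obtain ⟨d, y', hy', hye⟩ := hπ.exists_sub_mem y hyV
    have hc : c ≠ 0 := by
      rintro rfl
      apply hx
      rw [Submodule.Quotient.mk_eq_zero]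
      refine ⟨x', hx', ?_⟩
      change π * x' = x
      simp [hxe]
    refine ⟨algebraMap k R (d / c), ?_⟩
    rw [LinearMap.toSpanSingleton_apply, ← Submodule.Quotient.mk_smul, Submodule.Quotient.eq]
    refine ⟨algebraMap R K (algebraMap k R (d / c)) * x' - y', sub_mem
      ((integralClosure R K).mul_mem (Subalgebra.algebraMap_mem _ _) hx') hy', ?_⟩
    change π * (algebraMap R K (algebraMap k R (d / c)) * x' - y') =
      algebraMap k R (d / c) • x - y
    rw [Algebra.smul_def, hxe, hye, ← IsScalarTower.algebraMap_apply, map_div₀]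
    have : algebraMap k K c ≠ 0 := by simpa using hc
    field_simp
    ring

lemma ordFrac_zpow_mul (hfg : (Subalgebra.toSubmodule (integralClosure R K)).FG) (n : ℤ)
    {u : K} (hu : u ≠ 0) (huV : u ∈ integralClosure R K) (huV' : u⁻¹ ∈ integralClosure R K) :
    Ring.ordFrac R (π ^ n * u) = WithZero.exp n := by
  rw [map_mul, ordFrac_eq_one_of_inv_mem hfg hu huV huV', mul_one, map_zpow₀,
    hπ.ordFrac_self hfg, ← WithZero.exp_zsmul]
  simp

omit [IsDomain R] [IsNoetherianRing R] [Ring.KrullDimLE 1 R] [IsFractionRing R K] [Algebra k R]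
  [IsScalarTower k R K] in
lemma zpow_mul_mem_iff (n : ℤ) {u : K} (hu : u ≠ 0) (huV : u ∈ integralClosure R K)
    (huV' : u⁻¹ ∈ integralClosure R K) : π ^ n * u ∈ integralClosure R K ↔ 0 ≤ n := by
  constructor
  · intro h
    by_contra hn
    obtain ⟨m, rfl⟩ : ∃ m : ℕ, n = -(m + 1 : ℤ) := ⟨(-n - 1).toNat, by omega⟩
    apply hπ.inv_notMem
    have hπ0 := hπ.ne_zero
    have : π⁻¹ = π ^ m * (π ^ (-(m + 1 : ℤ)) * u) * u⁻¹ := by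
      rw [zpow_neg, zpow_add₀ hπ0, zpow_natCast]
      field_simp
    rw [this]
    exact mul_mem (mul_mem (pow_mem hπ.mem m) h) huV'
  · intro hn
    lift n to ℕ using hn
    rw [zpow_natCast]
    exact mul_mem (pow_mem hπ.mem n) huV

/-- The normalization of `R` is the set of elements of nonnegative order. -/
lemma mem_integralClosure_iff (hfg : (Subalgebra.toSubmodule (integralClosure R K)).FG)
    {x : K} (hx : x ≠ 0) : x ∈ integralClosure R K ↔ 1 ≤ Ring.ordFrac R x := by
  obtain ⟨n, u, hu, hu', rfl⟩ := hπ.exists_eq_zpow_mul x hx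
  have hu0 : u ≠ 0 := right_ne_zero_of_mul hx
  rw [hπ.zpow_mul_mem_iff n hu0 hu hu', hπ.ordFrac_zpow_mul hfg n hu0 hu hu', ← WithZero.exp_zero,
    WithZero.exp_le_exp]

/-- Factoring out the term of smaller order leaves `1 + y/x`, which lies in the normalization and so
has nonnegative order. -/
lemma min_ordFrac_le_add (hfg : (Subalgebra.toSubmodule (integralClosure R K)).FG)
    {x y : K} (h : x + y ≠ 0) :
    min (Ring.ordFrac R x) (Ring.ordFrac R y) ≤ Ring.ordFrac R (x + y) := by
  wlog hxy : Ring.ordFrac R x ≤ Ring.ordFrac R y generalizing x y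
  · rw [min_comm, add_comm x y]
    exact this (by rwa [add_comm]) (le_of_not_ge hxy)
  rw [min_eq_left hxy]
  by_cases hx : x = 0
  · simp [hx]
  have hx' : 0 < Ring.ordFrac R x := zero_lt_iff.mpr (by simpa using hx)
  have hdiv : y / x ∈ integralClosure R K := by
    by_cases hy : y = 0
    · simp [hy]
    rw [hπ.mem_integralClosure_iff hfg (div_ne_zero hy hx), map_div₀]
    exact (one_le_div₀ hx').mpr hxy
  have h1 : 1 + y / x ∈ integralClosure R K := add_mem (one_mem _) hdiv
  have hsplit : x + y = x * (1 + y / x) := by field_simp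
  rw [hsplit] at h ⊢
  rw [hπ.mem_integralClosure_iff hfg (right_ne_zero_of_mul h)] at h1
  rw [map_mul]
  exact le_mul_of_one_le_right' h1

/-- Two elements of the same order have the same leading term up to a constant. -/
lemma exists_sub_eq_zero_or_lt (hfg : (Subalgebra.toSubmodule (integralClosure R K)).FG)
    {x y : K} (hy : y ≠ 0) (hxy : Ring.ordFrac R x = Ring.ordFrac R y) :
    ∃ c : k, x - algebraMap k K c * y = 0 ∨
      Ring.ordFrac R y < Ring.ordFrac R (x - algebraMap k K c * y) := by
  have hy' : Ring.ordFrac R y ≠ 0 := by simpa using hy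
  have hx : x ≠ 0 := by
    rintro rfl
    simp only [map_zero] at hxy
    exact hy' hxy.symm
  have hdiv : x / y ∈ integralClosure R K := by
    rw [hπ.mem_integralClosure_iff hfg (div_ne_zero hx hy), map_div₀, hxy, div_self hy']
  obtain ⟨c, z, hz, hzc⟩ := hπ.exists_sub_mem _ hdiv
  refine ⟨c, ?_⟩
  have hsplit : x - algebraMap k K c * y = π * z * y := by
    rw [div_eq_iff hy] at hzc
    rw [hzc]; ring
  rw [hsplit]
  by_cases hz0 : z = 0
  · left; simp [hz0]
  right
  rw [hπ.mem_integralClosure_iff hfg hz0] at hz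
  rw [map_mul, map_mul, hπ.ordFrac_self hfg]
  have h1 : (1 : WithZero (Multiplicative ℤ)) < WithZero.exp 1 * Ring.ordFrac R z := by
    calc (1 : WithZero (Multiplicative ℤ)) < WithZero.exp 1 := by
          rw [← WithZero.exp_zero, WithZero.exp_lt_exp]; norm_num
      _ ≤ _ := le_mul_of_one_le_right' hz
  calc Ring.ordFrac R y = 1 * Ring.ordFrac R y := (one_mul _).symm
    _ < _ := mul_lt_mul_of_pos_right h1 (zero_lt_iff.mpr hy')

end IsBranchUniformizer

open IntermediateField in
/-- The order of vanishing along a unibranch local ring `R` of the rational function field `k(T)`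
is the order at a point `P` of the projective line `k ∪ {∞}`. -/
theorem exists_isBranchUniformizer_and_place [IsAlgClosed k] [DecidableEq k] [IsLocalRing R]
    [IsLocalRing (integralClosure R K)] (hR : ¬ IsField R) {T : K} (hT : k⟮T⟯ = ⊤) :
    ∃ π : K, IsBranchUniformizer k R π ∧
      (Subalgebra.toSubmodule (integralClosure R K)).FG ∧
      ∃ P : Option k, ∀ b : k, Ring.ordFrac R (T - algebraMap k K b) =
        WithZero.exp ((if P = some b then 1 else 0) - (if P = none then 1 else 0) : ℤ) := by
  have := IsAlgClosed.instInfinite (K := k)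
  obtain ⟨c, hc⟩ := exists_inv_sub_mem_integralClosure (k := k) hR hT
  set S := (T - algebraMap k K c)⁻¹ with hS
  have hTS : T = algebraMap k K c + S⁻¹ := by rw [hS, inv_inv]; ring
  have hS' : k⟮S⟯ = ⊤ := by
    rw [eq_top_iff, ← hT, adjoin_simple_le_iff, hTS]
    exact add_mem (IntermediateField.algebraMap_mem _ _) (inv_mem (mem_adjoin_simple_self k S))
  obtain ⟨a, ha0, ha⟩ := exists_inv_sub_notMem_integralClosure (k := k) hR hS' hc
  have hπ := isBranchUniformizer_sub_of_mem hS' hc ha0 ha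
  have hfg := fg_integralClosure_of_mem hS' hc ha0 ha
  have hconst (d : k) (hd : d ≠ 0) : Ring.ordFrac R (algebraMap k K d) = 1 :=
    ordFrac_eq_one_of_inv_mem hfg (by simpa using hd) (algebraMap_mem_of_isScalarTower _ _)
      (by rw [← map_inv₀]; exact algebraMap_mem_of_isScalarTower _ _)
  have hlin (d : k) (hd : d ≠ a) : S - algebraMap k K d ≠ 0 ∧
      Ring.ordFrac R (S - algebraMap k K d) = 1 := by
    have h := inv_aeval_mem_integralClosure hc ha
      (p := Polynomial.X - Polynomial.C d) (by simpa [sub_eq_zero] using hd.symm)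
    simp only [map_sub, Polynomial.aeval_X, Polynomial.aeval_C] at h
    exact ⟨h.1, ordFrac_eq_one_of_inv_mem hfg h.1
      (sub_mem hc (algebraMap_mem_of_isScalarTower _ _)) h.2⟩
  have hS0 : S ≠ 0 := by
    intro h0
    apply ha
    rw [h0, zero_sub, ← map_neg, ← map_inv₀]
    exact algebraMap_mem_of_isScalarTower _ _
  refine ⟨_, hπ, hfg, ?_⟩
  -- The branch is centred at `S = a`, where `T = c + 1/S`: this is `∞` if `a = 0` and the finite
  -- point `c + a⁻¹` otherwise.
  by_cases ha' : a = 0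
  · refine ⟨none, fun b => ?_⟩
    have hSord : Ring.ordFrac R S = WithZero.exp 1 := by
      have := hπ.ordFrac_self hfg
      simpa [ha'] using this
    have hnum : Ring.ordFrac R (1 + algebraMap k K (c - b) * S) = 1 := by
      by_cases hcb : c - b = 0
      · simp [hcb]
      have hcb' : algebraMap k K (c - b) ≠ 0 := (_root_.map_ne_zero _).mpr hcb
      -- The numerator `1 + (c - b) S` has its root at `S = -(c - b)⁻¹`, which differs from the
      -- centre `0`.
      have h := (hlin (-(c - b)⁻¹) (by rw [ha']; simpa using hcb)).2
      have : 1 + algebraMap k K (c - b) * S =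
          algebraMap k K (c - b) * (S - algebraMap k K (-(c - b)⁻¹)) := by
        rw [map_neg, map_inv₀]; field_simp; ring
      rw [this, map_mul, h, hconst _ hcb, one_mul]
    have hTb : T - algebraMap k K b = (1 + algebraMap k K (c - b) * S) / S := by
      rw [hTS, map_sub]; field_simp; ring
    rw [hTb, map_div₀, hnum, hSord, one_div, ← WithZero.exp_neg]
    rfl
  · refine ⟨some (c + a⁻¹), fun b => ?_⟩
    have hSord : Ring.ordFrac R S = 1 := by
      have := (hlin 0 (Ne.symm ha')).2
      simpa using this
    have hTb : T - algebraMap k K b = (1 + algebraMap k K (c - b) * S) / S := by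
      rw [hTS, map_sub]; field_simp; ring
    rw [hTb, map_div₀, hSord, div_one]
    by_cases hcb : c - b = 0
    · have : ¬ c + a⁻¹ = b := by
        intro h
        rw [sub_eq_zero.mp hcb] at h
        simp [ha'] at h
      simp [hcb, this]
    · have hcb' : algebraMap k K (c - b) ≠ 0 := (_root_.map_ne_zero _).mpr hcb
      have hfac : 1 + algebraMap k K (c - b) * S =
          algebraMap k K (c - b) * (S - algebraMap k K (-(c - b)⁻¹)) := by
        rw [map_neg, map_inv₀]; field_simp; ring
      rw [hfac, map_mul, hconst _ hcb, one_mul]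
      by_cases hb : c + a⁻¹ = b
      · have : -(c - b)⁻¹ = a := by rw [← hb]; simp
        rw [this, hπ.ordFrac_self hfg]
        simp [hb]
      · rw [(hlin _ ?_).2]
        · simp [hb]
        · intro h
          apply hb
          rw [← h, inv_neg, inv_inv]; ring

end OrdFrac

attribute [local instance] MvPolynomial.gradedAlgebra

/-! ### Stalks of projective varieties as complex algebras -/

namespace ProjectiveVariety

/-- The constants `ℂ → Γ(X, 𝒪_X)`. -/
def constants (X : ProjectiveVariety) : ℂ →+* Γ(X.scheme, ⊤) :=
  ((Scheme.ΓSpecIso (.of ℂ)).inv ≫ X.hom.appTop).hom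

variable (X : ProjectiveVariety)

instance (z : X.scheme) : Algebra ℂ (X.scheme.presheaf.stalk z) :=
  ((X.scheme.presheaf.germ ⊤ z trivial).hom.comp X.constants).toAlgebra

lemma algebraMap_stalk_apply (z : X.scheme) (c : ℂ) :
    algebraMap ℂ (X.scheme.presheaf.stalk z) c =
      X.scheme.presheaf.germ ⊤ z trivial (X.constants c) := rfl

instance (z : X.scheme) :
    IsScalarTower ℂ (X.scheme.presheaf.stalk z) X.scheme.functionField :=
  .of_algebraMap_eq fun c => by
    change _ = algebraMap _ _ (X.scheme.presheaf.germ ⊤ z trivial (X.constants c))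
    exact (X.scheme.presheaf.germ_stalkSpecializes_apply
      (U := ⊤) trivial ((genericPoint_spec X.scheme).specializes trivial) (X.constants c)).symm

/-- Degree-zero polynomials are constants, so the map of `Proj`'s base to `Spec ℂ` is a closed
immersion, and `Proj` is proper over its degree-zero part. -/
instance (n : ℕ) : IsProper (projectiveSpaceHom n) := by
  have ht : IsScalarTower ℂ (MvPolynomial.homogeneousSubmodule (Fin (n + 1)) ℂ 0)
      (MvPolynomial (Fin (n + 1)) ℂ) :=
    ⟨fun a b c => smul_mul_assoc a (b : MvPolynomial (Fin (n + 1)) ℂ) c⟩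
  have h0 : Algebra.FiniteType (MvPolynomial.homogeneousSubmodule (Fin (n + 1)) ℂ 0)
      (MvPolynomial (Fin (n + 1)) ℂ) :=
    Algebra.FiniteType.of_restrictScalars_finiteType ℂ _ _
  have h1 : IsClosedImmersion (Spec.map (CommRingCat.ofHom
      (algebraMap ℂ (MvPolynomial.homogeneousSubmodule (Fin (n + 1)) ℂ 0)))) := by
    refine IsClosedImmersion.spec_of_surjective _ ?_
    rintro ⟨p, hp⟩
    rw [MvPolynomial.mem_homogeneousSubmodule] at hp
    refine ⟨MvPolynomial.coeff 0 p, Subtype.ext ?_⟩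
    exact ((MvPolynomial.totalDegree_eq_zero_iff_eq_C).mp
      (Nat.le_zero.mp hp.totalDegree_le)).symm
  unfold projectiveSpaceHom
  infer_instance

instance : IsProper X.hom := by
  obtain ⟨n, j, hj, h⟩ := X.isProjective
  rw [← h]
  infer_instance

/-- `W` dominates the local ring at `z`. -/
def Dominates (W : ValuationSubring X.scheme.functionField) (z : X.scheme) : Prop :=
  ∃ ψ : X.scheme.presheaf.stalk z →+* W, IsLocalHom ψ ∧
    ∀ r, (ψ r : X.scheme.functionField) = algebraMap _ _ r

variable {X}

lemma hom_eq_toSpecΓ_comp : X.hom =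
    X.scheme.toSpecΓ ≫ Spec.map (CommRingCat.ofHom X.constants) := by
  have h := Scheme.toSpecΓ_naturality X.hom
  rw [← SpecMap_ΓSpecIso_hom] at h
  have h2 : X.hom = (X.hom ≫ Spec.map (Scheme.ΓSpecIso (.of ℂ)).hom) ≫
      Spec.map (Scheme.ΓSpecIso (.of ℂ)).inv := by
    rw [Category.assoc, ← Spec.map_comp, Iso.inv_hom_id, Spec.map_id, Category.comp_id]
  rw [h, Category.assoc, ← Spec.map_comp] at h2
  exact h2

lemma fromSpecStalk_comp_hom (z : X.scheme) : X.scheme.fromSpecStalk z ≫ X.hom =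
    Spec.map (CommRingCat.ofHom (algebraMap ℂ (X.scheme.presheaf.stalk z))) := by
  rw [hom_eq_toSpecΓ_comp, Scheme.fromSpecStalk_toSpecΓ_assoc, ← Spec.map_comp]
  rfl

/-- The square for the valuative criterion given by a valuation ring of the function field. -/
def valuativeCommSq (W : ValuationSubring X.scheme.functionField)
    (hW : ∀ c : ℂ, algebraMap ℂ X.scheme.functionField c ∈ W) : ValuativeCommSq X.hom where
  R := W
  K := X.scheme.functionField
  i₁ := X.scheme.fromSpecStalk (genericPoint X.scheme)
  i₂ := Spec.map (CommRingCat.ofHom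
    ((algebraMap ℂ X.scheme.functionField).codRestrict W.toSubring hW))
  commSq := ⟨by
    rw [fromSpecStalk_comp_hom, ← Spec.map_comp]
    rfl⟩

variable (X) in
lemma valuativeCriterion_hom : ValuativeCriterion X.hom := by
  have h : IsProper X.hom := inferInstance
  rw [IsProper.eq_valuativeCriterion] at h
  exact h.1.1.1

/-- The existence half of the valuative criterion: the lift sends the closed point of `Spec W` to
the centre of `W`. -/
lemma exists_dominates (W : ValuationSubring X.scheme.functionField)
    (hW : ∀ c : ℂ, algebraMap ℂ X.scheme.functionField c ∈ W) :
    ∃ z : X.scheme, X.Dominates W z := by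
  obtain ⟨⟨l, hl₁, hl₂⟩⟩ := X.valuativeCriterion_hom.existence (valuativeCommSq W hW)
  change Spec (.of W) ⟶ X.scheme at l
  refine ⟨l (IsLocalRing.closedPoint (CommRingCat.of W)), (Scheme.stalkClosedPointTo l).hom,
    inferInstance, fun r => ?_⟩
  have h1 : Spec.map (CommRingCat.ofHom (algebraMap W X.scheme.functionField)) ≫
      Spec.map (Scheme.stalkClosedPointTo l) ≫ X.scheme.fromSpecStalk _ =
      X.scheme.fromSpecStalk (genericPoint X.scheme) := by
    rw [Scheme.Spec_stalkClosedPointTo_fromSpecStalk]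
    exact hl₁
  -- Since `fromSpecStalk` is a monomorphism, the lift's compatibility at the generic point descends
  -- to an identity of ring maps out of the stalk.
  rw [← Scheme.SpecMap_stalkSpecializes_fromSpecStalk ((genericPoint_spec X.scheme).specializes
      (y := l (IsLocalRing.closedPoint (CommRingCat.of W))) trivial), ← Category.assoc,
    cancel_mono, ← Spec.map_comp] at h1
  have h2 := Spec.map_injective h1
  exact congrArg (fun f => f.hom r) h2

/-- The uniqueness half of the valuative criterion: each dominated point yields a lift carrying the
closed point of `Spec W` to it. -/
lemma Dominates.eq {W : ValuationSubring X.scheme.functionField}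
    (hW : ∀ c : ℂ, algebraMap ℂ X.scheme.functionField c ∈ W)
    {z z' : X.scheme} (hz : X.Dominates W z) (hz' : X.Dominates W z') : z = z' := by
  have hu := X.valuativeCriterion_hom.uniqueness (valuativeCommSq W hW)
  have key (z : X.scheme) (hz : X.Dominates W z) :
      ∃ l : (valuativeCommSq W hW).commSq.LiftStruct,
        (show Spec (.of W) ⟶ X.scheme from l.l) (IsLocalRing.closedPoint (CommRingCat.of W)) =
          z := by
    obtain ⟨ψ, hψ, hψK⟩ := hz
    let ψ' : X.scheme.presheaf.stalk z ⟶ CommRingCat.of W := CommRingCat.ofHom ψ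
    refine ⟨⟨Spec.map ψ' ≫ X.scheme.fromSpecStalk z, ?_, ?_⟩, ?_⟩
    · change Spec.map (CommRingCat.ofHom (algebraMap W X.scheme.functionField)) ≫
        Spec.map ψ' ≫ X.scheme.fromSpecStalk z = X.scheme.fromSpecStalk (genericPoint X.scheme)
      rw [← Scheme.SpecMap_stalkSpecializes_fromSpecStalk
        ((genericPoint_spec X.scheme).specializes (y := z) trivial), ← Category.assoc,
        ← Spec.map_comp]
      congr 2
      ext r
      exact hψK r
    · change (Spec.map ψ' ≫ X.scheme.fromSpecStalk z) ≫ X.hom =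
        Spec.map (CommRingCat.ofHom
          ((algebraMap ℂ X.scheme.functionField).codRestrict W.toSubring hW))
      rw [Category.assoc, fromSpecStalk_comp_hom, ← Spec.map_comp]
      congr 1
      ext c
      refine (hψK _).trans ?_
      exact (IsScalarTower.algebraMap_apply ℂ (X.scheme.presheaf.stalk z) _ c).symm
    · change (Spec.map ψ' ≫ X.scheme.fromSpecStalk z)
        (IsLocalRing.closedPoint (CommRingCat.of W)) = z
      have : Spec.map ψ' (IsLocalRing.closedPoint (CommRingCat.of W)) =
          IsLocalRing.closedPoint (X.scheme.presheaf.stalk z) :=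
        IsLocalRing.comap_closedPoint ψ
      exact (congrArg (X.scheme.fromSpecStalk z) this).trans Scheme.fromSpecStalk_closedPoint
  obtain ⟨l, hl⟩ := key z hz
  obtain ⟨l', hl'⟩ := key z' hz'
  rw [← hl, ← hl', Subsingleton.elim l l']

end ProjectiveVariety

/-! ### Closed points of a curve and their normalizations -/

section Dimension

variable {C : Scheme.{0}} [IsIntegral C]

lemma coheight_eq_one_of_ne_genericPoint (hC : topologicalKrullDim C = 1) {z : C}
    (hz : z ≠ genericPoint C) : Order.coheight z = 1 := by
  have h1 : Order.krullDim C = 1 := by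
    rw [← hC]
    exact (Order.krullDim_eq_of_orderIso irreducibleSetEquivPoints).symm
  refine le_antisymm ?_ ?_
  · have := Order.coheight_le_krullDim z
    rw [h1] at this
    exact_mod_cast this
  · rw [Order.one_le_iff_pos, pos_iff_ne_zero, Ne, Order.coheight_eq_zero]
    intro hmax
    have hle : z ≤ genericPoint C := genericPoint_specializes z
    exact hz (Specializes.antisymm (hmax hle) hle).eq

omit [IsIntegral C] in
lemma not_isField_stalk_of_coheight_eq_one {z : C} (hz : Order.coheight z = 1) :
    ¬ IsField (C.presheaf.stalk z) := by
  intro h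
  have h1 := ringKrullDim_stalk_eq_coheight z
  rw [ringKrullDim_eq_zero_of_isField h, hz] at h1
  exact absurd h1 (by norm_num)

/-- Singular points are covered by cuspidality. A regular local ring of dimension one is integrally
closed, so at a regular point the normalization is the local ring itself. -/
lemma isLocalRing_integralClosure_stalk [IsLocallyNoetherian C] (hcusp : IsCuspidal C)
    {z : C} (hz : Order.coheight z = 1) :
    IsLocalRing (integralClosure (C.presheaf.stalk z) C.functionField) := by
  by_cases hs : IsSingularPoint C z
  · exact hcusp z hs
  have hreg : IsRegularLocalRing (C.presheaf.stalk z) := not_not.mp hs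
  have h1 := (IsRegularLocalRing.iff_finrank_cotangentSpace _).mp hreg
  rw [ringKrullDim_stalk_eq_coheight z, hz] at h1
  have h2 : Module.finrank (IsLocalRing.ResidueField (C.presheaf.stalk z))
      (IsLocalRing.CotangentSpace (C.presheaf.stalk z)) = 1 := by exact_mod_cast h1
  have := IsLocalRing.finrank_CotangentSpace_eq_one_iff.mp h2
  have h3 : integralClosure (C.presheaf.stalk z) C.functionField = ⊥ :=
    (IsIntegrallyClosed.integralClosure_eq_bot_iff _).mpr inferInstance
  rw [h3]
  exact (Algebra.botEquivOfInjective
    (IsFractionRing.injective (C.presheaf.stalk z) C.functionField)).symm.toRingEquiv.isLocalRing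

end Dimension

/-! ### Generators of the multiplicative group and valuations of `k(T)` -/

section Induction

open Polynomial IntermediateField

variable {k K : Type*} [Field k] [IsAlgClosed k] [Field K] [Algebra k K]

/-- The multiplicative group of `k(T)` is generated by the constants and the `T - b`. -/
lemma ne_zero_induction_of_adjoin_eq_top {T : K} (hT : k⟮T⟯ = ⊤) {Q : K → Prop}
    (hconst : ∀ c : k, c ≠ 0 → Q (algebraMap k K c))
    (hlin : ∀ b : k, T - algebraMap k K b ≠ 0 → Q (T - algebraMap k K b))
    (hmul : ∀ x y : K, x ≠ 0 → y ≠ 0 → Q x → Q y → Q (x * y))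
    (hinv : ∀ x : K, x ≠ 0 → Q x → Q x⁻¹) (x : K) (hx : x ≠ 0) : Q x := by
  have hprod (s : Multiset k) : (s.map fun b => T - algebraMap k K b).prod ≠ 0 →
      Q (s.map fun b => T - algebraMap k K b).prod := by
    induction s using Multiset.induction with
    | empty => intro _; simpa using hconst 1 one_ne_zero
    | cons b s ih =>
      intro h
      rw [Multiset.map_cons, Multiset.prod_cons] at h ⊢
      exact hmul _ _ (left_ne_zero_of_mul h) (right_ne_zero_of_mul h)
        (hlin b (left_ne_zero_of_mul h)) (ih (right_ne_zero_of_mul h))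
  have hpol (p : k[X]) (hp : aeval T p ≠ 0) : Q (aeval T p) := by
    rw [(IsAlgClosed.splits p).eq_prod_roots, map_mul, aeval_C, map_multiset_prod,
      Multiset.map_map] at hp ⊢
    simp only [Function.comp_def, map_sub, aeval_X, aeval_C] at hp ⊢
    exact hmul _ _ (left_ne_zero_of_mul hp) (right_ne_zero_of_mul hp)
      (hconst _ (by have := left_ne_zero_of_mul hp; simpa using this))
      (hprod _ (right_ne_zero_of_mul hp))
  obtain ⟨p, q, rfl⟩ := (mem_adjoin_simple_iff k x).mp (by rw [hT]; trivial)
  rw [div_ne_zero_iff] at hx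
  rw [div_eq_mul_inv]
  exact hmul _ _ hx.1 (inv_ne_zero hx.2) (hpol _ hx.1) (hinv _ hx.2 (hpol _ hx.2))

omit [IsAlgClosed k] in
-- `U` generates a proper ideal of `k[U]`: an inverse `p(U)` would give `X p = 1` by transcendence,
-- which fails at `0`. A valuation ring can be found in which this ideal consists of nonunits.
lemma exists_valuationSubring_mem_nonunits {U : K} (hU : Transcendental k U) :
    ∃ W : ValuationSubring K, (∀ c : k, algebraMap k K c ∈ W) ∧ U ∈ W.nonunits := by
  let A : Subring K := (Algebra.adjoin k {U}).toSubring
  have hUA : U ∈ A := Algebra.self_mem_adjoin_singleton k U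
  have hI : Ideal.span {(⟨U, hUA⟩ : A)} ≠ ⊤ := by
    rw [Ne, Ideal.span_singleton_eq_top]
    intro hu
    obtain ⟨⟨y, hy⟩, hUy⟩ := hu.exists_right_inv
    have hUy : U * y = 1 := congrArg Subtype.val hUy
    obtain ⟨p, rfl⟩ : ∃ p : k[X], aeval U p = y := by
      have hy : y ∈ Algebra.adjoin k {U} := hy
      rwa [Algebra.adjoin_singleton_eq_range_aeval] at hy
    have h := (transcendental_iff.mp hU) (X * p - 1) (by simp [hUy])
    simpa using congrArg (eval 0) h
  obtain ⟨W, hAW, hW⟩ := Ideal.image_subset_nonunits_valuationSubring _ hI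
  exact ⟨W, fun c => hAW ((Algebra.adjoin k {U}).algebraMap_mem c),
    hW ⟨_, Ideal.subset_span rfl, rfl⟩⟩

end Induction

/-! ### The function field of a rational curve -/

section FunctionField

/-- An open immersion of integral schemes induces an isomorphism of function fields. -/
lemma exists_functionField_equiv {U Y : Scheme.{0}} [IsIntegral U] [IsIntegral Y] (g : U ⟶ Y)
    [IsOpenImmersion g] : ∃ φ : Y.functionField ≃+* U.functionField, ∀ s : Γ(Y, ⊤),
      φ (Y.presheaf.germ ⊤ _ trivial s) = U.presheaf.germ ⊤ _ trivial (g.appTop s) := by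
  have heq : g (genericPoint U) = genericPoint Y := genericPoint_eq_of_isOpenImmersion g
  let φ : Y.functionField ⟶ U.functionField :=
    (Y.presheaf.stalkCongr (.of_eq heq)).inv ≫ g.stalkMap (genericPoint U)
  have : IsIso φ := inferInstance
  refine ⟨(asIso φ).commRingCatIsoToRingEquiv, fun s => ?_⟩
  have h1 : (Y.presheaf.stalkCongr (.of_eq heq)).inv (Y.presheaf.germ ⊤ _ trivial s) =
      Y.presheaf.germ ⊤ (g (genericPoint U)) trivial s :=
    Y.presheaf.germ_stalkSpecializes_apply (U := ⊤) trivial (specializes_of_eq heq) s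
  change g.stalkMap (genericPoint U) ((Y.presheaf.stalkCongr (.of_eq heq)).inv _) = _
  rw [h1]
  exact g.germ_stalkMap_apply ⊤ _ trivial s

instance : IsIntegral 𝔸(PUnit; Spec (.of ℂ)) :=
  isIntegral_of_isOpenImmersion (AffineSpace.SpecIso PUnit (.of ℂ)).hom

open IntermediateField in
/-- The function field of a rational curve is generated by one element. -/
theorem exists_adjoin_simple_eq_top (C : ProjectiveVariety)
    (hrat : Scheme.BirationalOver C.hom (𝔸(PUnit; Spec (.of ℂ)) ↘ Spec (.of ℂ))) :
    ∃ T : C.scheme.functionField, ℂ⟮T⟯ = ⊤ := by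
  obtain ⟨f, hf⟩ := hrat
  let Y : Scheme.{0} := 𝔸(PUnit; Spec (.of ℂ))
  have hne : Nonempty f.source := by
    obtain ⟨x, hx⟩ := f.dense_source.nonempty
    exact ⟨⟨x, hx⟩⟩
  let g : f.source.toScheme ⟶ Y := f.iso.hom ≫ f.target.ι
  have hg : g ≫ (Y ↘ Spec (.of ℂ)) = f.source.ι ≫ C.hom := by
    rw [← hf, Category.assoc]
  obtain ⟨φ₁, hφ₁⟩ := exists_functionField_equiv f.source.ι
  obtain ⟨φ₂, hφ₂⟩ := exists_functionField_equiv g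
  -- Pulls polynomial functions on the affine line back to rational functions on `C` through the
  -- common open subset; the generator is the image of the coordinate.
  let θ : Γ(Y, ⊤) →+* C.scheme.functionField :=
    (φ₁.symm.toRingHom.comp φ₂.toRingHom).comp (Y.presheaf.germ ⊤ (genericPoint Y) trivial).hom
  have hθ (s : Γ(Y, ⊤)) : θ s = φ₁.symm (φ₂ (Y.presheaf.germ ⊤ (genericPoint Y) trivial s)) := rfl
  let κ : ℂ →+* Γ(Y, ⊤) := ((Scheme.ΓSpecIso _).inv ≫ (Y ↘ Spec (.of ℂ)).appTop).hom
  have hθκ (c : ℂ) : θ (κ c) = algebraMap ℂ _ c := by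
    rw [hθ, RingEquiv.symm_apply_eq, hφ₂, ProjectiveVariety.algebraMap_stalk_apply, hφ₁]
    congr 1
    change ((Scheme.ΓSpecIso (.of ℂ)).inv ≫ (Y ↘ Spec (.of ℂ)).appTop ≫ g.appTop) c =
      ((Scheme.ΓSpecIso (.of ℂ)).inv ≫ C.hom.appTop ≫ f.source.ι.appTop) c
    rw [← Scheme.Hom.comp_appTop, ← Scheme.Hom.comp_appTop, hg]
  refine ⟨θ (AffineSpace.coord _ PUnit.unit), eq_top_iff.mpr fun x _ => ?_⟩
  have hmem (s : Γ(Y, ⊤)) : θ s ∈ ℂ⟮θ (AffineSpace.coord _ PUnit.unit)⟯ := by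
    have hsurj : Function.Surjective
        (MvPolynomial.eval₂Hom κ (AffineSpace.coord (n := PUnit) (Spec (.of ℂ)))) := by
      have h := AffineSpace.SpecIso_hom_appTop (n := PUnit) (.of ℂ)
      rw [← Iso.inv_comp_eq] at h
      have happ : IsIso (AffineSpace.SpecIso PUnit (.of ℂ)).hom.appTop :=
        inferInstanceAs (IsIso ((AffineSpace.SpecIso PUnit (.of ℂ)).hom.app ⊤))
      have hiso : IsIso (CommRingCat.ofHom
          (MvPolynomial.eval₂Hom κ (AffineSpace.coord (n := PUnit) (Spec (.of ℂ))))) :=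
        h ▸ IsIso.comp_isIso
      exact ((ConcreteCategory.isIso_iff_bijective _).mp hiso).2
    obtain ⟨p, rfl⟩ := hsurj s
    induction p using MvPolynomial.induction_on with
    | C c =>
      rw [MvPolynomial.coe_eval₂Hom, MvPolynomial.eval₂_C, hθκ]
      exact IntermediateField.algebraMap_mem _ c
    | add p q hp hq => rw [map_add, map_add]; exact add_mem hp hq
    | mul_X p i hp =>
      rw [map_mul, map_mul, MvPolynomial.coe_eval₂Hom, MvPolynomial.eval₂_X]
      exact mul_mem hp (mem_adjoin_simple_self ℂ _)
  have : Nonempty (⊤ : Y.Opens) := ⟨⟨genericPoint Y, trivial⟩⟩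
  have hfrac := functionField_isFractionRing_of_isAffineOpen Y ⊤ (isAffineOpen_top Y)
  obtain ⟨a, b, -, hab⟩ := IsFractionRing.div_surjective (A := Γ(Y, ⊤)) (φ₂.symm (φ₁ x))
  have hx : x = θ a / θ b := by
    rw [hθ, hθ, ← map_div₀, ← map_div₀]
    rw [RingEquiv.eq_symm_apply, ← RingEquiv.symm_apply_eq, ← hab]
    rfl
  rw [hx]
  exact div_mem (hmem a) (hmem b)

end FunctionField

/-! ### Valuation rings above a unibranch local ring -/

namespace IsBranchUniformizer

variable {k K R : Type*} [Field k] [Field K] [Algebra k K] [CommRing R] [Algebra R K]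
  {π : K} (hπ : IsBranchUniformizer k R π)

include hπ in
/-- The normalization of `R` is the only nontrivial valuation ring that contains `R`. -/
lemma mem_valuationSubring_iff {W : ValuationSubring K}
    (hRW : ∀ r : R, algebraMap R K r ∈ W) {y : K} (hy : y ∉ W) (x : K) :
    x ∈ W ↔ x ∈ integralClosure R K := by
  have hVW (x : K) (hx : x ∈ integralClosure R K) : x ∈ W := by
    have hx : IsIntegral R x := hx
    obtain ⟨p, hp, hpx⟩ := hx
    have : IsIntegral W x := by
      refine ⟨p.map ((algebraMap R K).codRestrict W.toSubring hRW), hp.map _, ?_⟩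
      rw [Polynomial.eval₂_map]
      exact hpx
    obtain ⟨w, rfl⟩ := IsIntegrallyClosed.isIntegral_iff.mp this
    exact w.2
  refine ⟨fun hx => ?_, hVW x⟩
  by_cases hx0 : x = 0
  · simp [hx0]
  obtain ⟨n, u, hu, hu', rfl⟩ := hπ.exists_eq_zpow_mul x hx0
  have hu0 : u ≠ 0 := right_ne_zero_of_mul hx0
  rw [hπ.zpow_mul_mem_iff n hu0 hu hu']
  by_contra hn
  -- An element of negative order in `W` would bring `π⁻¹` along; then `W` is the whole field,
  -- against `y ∉ W`.
  have hπW : π⁻¹ ∈ W := by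
    obtain ⟨m, rfl⟩ : ∃ m : ℕ, n = -(m + 1 : ℤ) := ⟨(-n - 1).toNat, by omega⟩
    have hπ0 := hπ.ne_zero
    have : π⁻¹ = π ^ m * (π ^ (-(m + 1 : ℤ)) * u) * u⁻¹ := by
      rw [zpow_neg, zpow_add₀ hπ0, zpow_natCast]
      field_simp
    rw [this]
    exact mul_mem (mul_mem (pow_mem (hVW _ hπ.mem) m) hx) (hVW _ hu')
  apply hy
  by_cases hy0 : y = 0
  · simp [hy0]
  obtain ⟨m, v, hv, -, rfl⟩ := hπ.exists_eq_zpow_mul y hy0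
  refine mul_mem ?_ (hVW _ hv)
  rcases m with m | m
  · rw [Int.ofNat_eq_natCast, zpow_natCast]
    exact pow_mem (hVW _ hπ.mem) m
  · rw [zpow_negSucc, ← inv_pow]
    exact pow_mem hπW _

end IsBranchUniformizer

lemma inv_algebraMap_notMem_integralClosure {R K : Type*} [CommRing R] [IsDomain R] [Field K]
    [Algebra R K] [IsFractionRing R K] {r : R} (hr : ¬ IsUnit r) (hr0 : r ≠ 0) :
    (algebraMap R K r)⁻¹ ∉ integralClosure R K := by
  intro h
  have hloc : IsLocalHom (algebraMap R (integralClosure R K)) := inferInstance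
  refine hr (hloc.map_nonunit r (.of_mul_eq_one ⟨_, h⟩ (Subtype.ext ?_)))
  exact mul_inv_cancel₀ (by simpa using hr0)

/-! ### Points of the curve as points of `ℙ¹`, and principal divisors -/

namespace ProjectiveVariety

open IntermediateField

variable {C : ProjectiveVariety}

/-- The order of vanishing at `z` is the order at the point `P` of the projective line with
coordinate `T`. -/
def IsPlaceAt (T : C.scheme.functionField) (z : C.scheme) (P : Option ℂ) : Prop :=
  ∃ hz : Order.coheight z = 1, ∀ b : ℂ, C.scheme.ordHom z hz (T - algebraMap ℂ _ b) =
    WithZero.exp ((if P = some b then 1 else 0) - (if P = none then 1 else 0) : ℤ)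

/-- At a finite place `b` only `T - b` has order `1`, while at infinity every `T - b` has order
`-1`; the orders therefore determine the place. -/
lemma IsPlaceAt.unique {T : C.scheme.functionField} {z : C.scheme} {P P' : Option ℂ}
    (hP : IsPlaceAt T z P) (hP' : IsPlaceAt T z P') : P = P' := by
  obtain ⟨_, hP⟩ := hP
  obtain ⟨_, hP'⟩ := hP'
  have h (b : ℂ) := WithZero.exp_injective ((hP b).symm.trans (hP' b))
  cases P with
  | none =>
    cases P' with
    | none => rfl
    | some b => have := h b; simp at this
  | some b =>
    have := h b
    cases P' with
    | none => simp at this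
    | some b' =>
      by_contra hne
      have hne' : ¬ b' = b := fun h => hne (by rw [h])
      simp [hne'] at this

/-- All points of `C` of codimension one are unibranch. -/
lemma exists_uniformizer (hcusp : IsCuspidal C.scheme) {T : C.scheme.functionField}
    (hT : ℂ⟮T⟯ = ⊤) {z : C.scheme} (hz : Order.coheight z = 1) :
    ∃ π, IsBranchUniformizer ℂ (C.scheme.presheaf.stalk z) (K := C.scheme.functionField) π ∧
      (Subalgebra.toSubmodule
        (integralClosure (C.scheme.presheaf.stalk z) C.scheme.functionField)).FG ∧
      ∃ P, IsPlaceAt T z P := by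
  have : Ring.KrullDimLE 1 (C.scheme.presheaf.stalk z) := krullDimLE_of_coheight_le hz.le
  have := isLocalRing_integralClosure_stalk hcusp hz
  obtain ⟨π, h1, h2, P, h3⟩ := exists_isBranchUniformizer_and_place (k := ℂ)
    (not_isField_stalk_of_coheight_eq_one hz) hT
  exact ⟨π, h1, h2, P, hz, h3⟩

lemma ordHom_algebraMap {z : C.scheme} (hz : Order.coheight z = 1) {c : ℂ} (hc : c ≠ 0) :
    C.scheme.ordHom z hz (algebraMap ℂ _ c) = 1 := by
  have : Ring.KrullDimLE 1 (C.scheme.presheaf.stalk z) := krullDimLE_of_coheight_le hz.le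
  rw [IsScalarTower.algebraMap_apply ℂ (C.scheme.presheaf.stalk z)]
  exact Ring.ordFrac_of_isUnit ((IsUnit.mk0 c hc).map (algebraMap ℂ _))

/-- Both orders are multiplicative and agree on the constants and on all `T - b`, which generate the
multiplicative group of the function field. -/
lemma IsPlaceAt.ordHom_eq {T : C.scheme.functionField} (hT : ℂ⟮T⟯ = ⊤) {z z' : C.scheme}
    {P : Option ℂ} (hz : Order.coheight z = 1) (hz' : Order.coheight z' = 1)
    (hP : IsPlaceAt T z P) (hP' : IsPlaceAt T z' P) (x : C.scheme.functionField) :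
    C.scheme.ordHom z hz x = C.scheme.ordHom z' hz' x := by
  by_cases hx : x = 0
  · simp [hx]
  obtain ⟨_, hP⟩ := hP
  obtain ⟨_, hP'⟩ := hP'
  refine ne_zero_induction_of_adjoin_eq_top (k := ℂ) hT
    (Q := fun x => C.scheme.ordHom z hz x = C.scheme.ordHom z' hz' x) ?_ ?_ ?_ ?_ x hx
  · intro c hc
    rw [ordHom_algebraMap hz hc, ordHom_algebraMap hz' hc]
  · intro b _
    rw [hP, hP']
  · intro x y _ _ hx hy
    rw [map_mul, map_mul, hx, hy]
  · intro x _ hx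
    rw [map_inv₀, map_inv₀, hx]

lemma sub_algebraMap_ne_zero {T : C.scheme.functionField} {z : C.scheme} {P : Option ℂ}
    (hP : IsPlaceAt T z P) (b : ℂ) : T - algebraMap ℂ _ b ≠ 0 := by
  obtain ⟨_, hP⟩ := hP
  intro h
  have := hP b
  rw [h, map_zero] at this
  exact WithZero.exp_ne_zero this.symm

/-- An algebraic `T` would be a constant `b`, but `T - b` has a finite order. -/
lemma IsPlaceAt.transcendental {T : C.scheme.functionField} {z : C.scheme} {P : Option ℂ}
    (hP : IsPlaceAt T z P) : Transcendental ℂ T := by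
  intro h
  obtain ⟨b, hb⟩ := minpoly.mem_range_of_degree_eq_one ℂ T
    (IsAlgClosed.degree_eq_one_of_irreducible ℂ (minpoly.irreducible h.isIntegral))
  exact sub_algebraMap_ne_zero hP b (by rw [hb, sub_self])

lemma mem_integralClosure_iff_ordHom (hcusp : IsCuspidal C.scheme) {T : C.scheme.functionField}
    (hT : ℂ⟮T⟯ = ⊤) {z : C.scheme} (hz : Order.coheight z = 1) {x : C.scheme.functionField}
    (hx : x ≠ 0) : x ∈ integralClosure (C.scheme.presheaf.stalk z) C.scheme.functionField ↔
      1 ≤ C.scheme.ordHom z hz x := by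
  have : Ring.KrullDimLE 1 (C.scheme.presheaf.stalk z) := krullDimLE_of_coheight_le hz.le
  obtain ⟨π, hπ, hfg, -⟩ := exists_uniformizer hcusp hT hz
  exact hπ.mem_integralClosure_iff hfg hx

/-- Every point of the projective line lies over a unique closed point of the curve. -/
lemma exists_unique_isPlaceAt (hC : topologicalKrullDim C.scheme = 1)
    (hcusp : IsCuspidal C.scheme) {T : C.scheme.functionField} (hT : ℂ⟮T⟯ = ⊤)
    (hTt : Transcendental ℂ T) (P : Option ℂ) :
    ∃! z : C.scheme, IsPlaceAt T z P := by
  -- `U` is the local coordinate of `ℙ¹` at `P`; the point sought is the centre on `C` of a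
  -- valuation ring in which `U` is a nonunit.
  let U : C.scheme.functionField := P.elim T⁻¹ fun b => T - algebraMap ℂ _ b
  have hU : Transcendental ℂ U := by
    cases P with
    | none => exact fun h => hTt (IsAlgebraic.inv_iff.mp h)
    | some b =>
      intro h
      have h' := h.add (isAlgebraic_algebraMap b)
      simp only [U, Option.elim_some, sub_add_cancel] at h'
      exact hTt h'
  obtain ⟨W, hkW, hUW⟩ := exists_valuationSubring_mem_nonunits hU
  have hU0 : U ≠ 0 := fun h => hU (h ▸ isAlgebraic_zero)
  have hUinv : U⁻¹ ∉ W := (W.mem_nonunits_iff_or.mp hUW).resolve_left hU0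
  obtain ⟨z, hzW⟩ := exists_dominates W hkW
  -- At the generic point `W` would contain the whole function field, including `U⁻¹`.
  have hzgen : z ≠ genericPoint C.scheme := by
    rintro rfl
    obtain ⟨ψ, -, hψ⟩ := hzW
    apply hUinv
    have h : (ψ U⁻¹ : C.scheme.functionField) = U⁻¹ := by
      rw [hψ]
      change C.scheme.presheaf.stalkSpecializes _ U⁻¹ = U⁻¹
      rw [TopCat.Presheaf.stalkSpecializes_refl]
      rfl
    rw [← h]
    exact (ψ U⁻¹).2
  have hz := coheight_eq_one_of_ne_genericPoint hC hzgen
  obtain ⟨π, hπ, -, P', hP'⟩ := exists_uniformizer hcusp hT hz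
  have hRW (r : C.scheme.presheaf.stalk z) : algebraMap _ C.scheme.functionField r ∈ W := by
    obtain ⟨ψ, -, hψ⟩ := hzW
    rw [← hψ]; exact (ψ r).2
  have hWz := hπ.mem_valuationSubring_iff hRW hUinv
  have hord (x : C.scheme.functionField) (hx : x ≠ 0) :
      x ∈ W ↔ 1 ≤ C.scheme.ordHom z hz x := by
    rw [hWz, mem_integralClosure_iff_ordHom hcusp hT hz hx]
  have hPP' : P' = P := by
    have h1 : 1 < C.scheme.ordHom z hz U := by
      rw [hord _ (inv_ne_zero hU0), map_inv₀, not_le] at hUinv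
      exact (inv_lt_one₀ (zero_lt_iff.mpr (by simpa using hU0))).mp hUinv
    obtain ⟨_, hP'⟩ := hP'
    cases P with
    | none =>
      have h2 := hP' 0
      simp only [map_zero, sub_zero] at h2
      change 1 < C.scheme.ordHom z hz T⁻¹ at h1
      rw [map_inv₀, h2, ← WithZero.exp_neg, ← WithZero.exp_zero, WithZero.exp_lt_exp] at h1
      by_contra hne
      rw [if_neg hne] at h1
      split_ifs at h1 <;> omega
    | some b =>
      change 1 < C.scheme.ordHom z hz (T - algebraMap ℂ _ b) at h1
      rw [hP' b, ← WithZero.exp_zero, WithZero.exp_lt_exp] at h1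
      by_contra hne
      rw [if_neg hne] at h1
      split_ifs at h1 <;> omega
  rw [hPP'] at hP'
  refine ⟨z, hP', fun z' hPz' => ?_⟩
  obtain ⟨hz', -⟩ := id hPz'
  -- A second point with place `P` has the same order function, so `W` is its normalization as well
  -- and dominates it; separatedness identifies the points.
  refine Dominates.eq hkW ?_ hzW
  have hWz' (x : C.scheme.functionField) :
      x ∈ W ↔ x ∈ integralClosure (C.scheme.presheaf.stalk z') C.scheme.functionField := by
    by_cases hx : x = 0
    · simp [hx]
    rw [hord x hx, mem_integralClosure_iff_ordHom hcusp hT hz' hx,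
      IsPlaceAt.ordHom_eq hT hz hz' hP' hPz']
  refine ⟨(algebraMap (C.scheme.presheaf.stalk z') C.scheme.functionField).codRestrict W.toSubring
    fun r => (hWz' _).mpr (Subalgebra.algebraMap_mem _ r), ⟨fun r hr => ?_⟩, fun r => rfl⟩
  by_contra hru
  have hr0 : r ≠ 0 := by
    rintro rfl
    simp at hr
  apply inv_algebraMap_notMem_integralClosure (K := C.scheme.functionField) hru hr0
  rw [← hWz']
  obtain ⟨y, hy⟩ := hr.exists_right_inv
  have hy : algebraMap _ C.scheme.functionField r * y = 1 := congrArg Subtype.val hy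
  rw [← eq_inv_of_mul_eq_one_right hy]
  exact y.2

/-- A principal divisor on a rational cuspidal curve has degree zero. -/
theorem exists_principalDivisor (hC : topologicalKrullDim C.scheme = 1)
    (hcusp : IsCuspidal C.scheme) {T : C.scheme.functionField} (hT : ℂ⟮T⟯ = ⊤)
    {z₀ : C.scheme} (hz₀ : Order.coheight z₀ = 1) (f : C.scheme.functionField) (hf : f ≠ 0) :
    ∃ D : C.scheme →₀ ℤ, (∀ z, C.scheme.ord f z = D z) ∧ (D.sum fun _ m => m) = 0 := by
  classical
  obtain ⟨-, -, -, P₀, hP₀⟩ := exists_uniformizer hcusp hT hz₀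
  have hTt := hP₀.transcendental
  refine ne_zero_induction_of_adjoin_eq_top (k := ℂ) hT
    (Q := fun f => ∃ D : C.scheme →₀ ℤ, (∀ z, C.scheme.ord f z = D z) ∧
      (D.sum fun _ m => m) = 0) ?_ ?_ ?_ ?_ f hf
  · intro c hc
    refine ⟨0, fun z => ?_, by simp⟩
    by_cases hz : Order.coheight z = 1
    · rw [Finsupp.zero_apply, Scheme.ord_eq_iff hz (by simpa using hc), ordHom_algebraMap hz hc]
      rfl
    · simp [hz]
  · intro b hb
    obtain ⟨zb, hzb, hzbu⟩ := exists_unique_isPlaceAt hC hcusp hT hTt (some b)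
    obtain ⟨zi, hzi, hziu⟩ := exists_unique_isPlaceAt hC hcusp hT hTt none
    -- The divisor of `T - b`: the point over `b` minus the point over `∞`.
    refine ⟨Finsupp.single zb 1 - Finsupp.single zi 1, fun z => ?_, ?_⟩
    · by_cases hz : Order.coheight z = 1
      · obtain ⟨-, -, -, P, hP⟩ := exists_uniformizer hcusp hT hz
        obtain ⟨_, hP'⟩ := id hP
        have h1 : C.scheme.ord (T - algebraMap ℂ _ b) z =
            (if P = some b then 1 else 0) - (if P = none then 1 else 0) := by
          rw [Scheme.ord_eq_iff hz hb, hP']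
          rfl
        have hne : zb ≠ zi := by
          rintro rfl
          exact Option.some_ne_none b (hzb.unique hzi)
        rw [h1, Finsupp.sub_apply]
        by_cases hPb : P = some b
        · rw [hzbu z (hPb ▸ hP)]
          simp [hPb, hne.symm]
        · have hzzb : zb ≠ z := by
            rintro rfl
            exact hPb (hP.unique hzb)
          by_cases hPi : P = none
          · rw [hziu z (hPi ▸ hP)]
            simp [hPi, hne]
          · have hzzi : zi ≠ z := by
              rintro rfl
              exact hPi (hP.unique hzi)
            simp [hPb, hPi, hzzb, hzzi]
      · rw [Scheme.ord_eq_zero_of_coheight_neq_one hz]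
        have h1 : zb ≠ z := by rintro rfl; exact hz hzb.1
        have h2 : zi ≠ z := by rintro rfl; exact hz hzi.1
        simp [h1, h2]
    · rw [Finsupp.sum_sub_index (by simp)]
      simp
  · rintro x y hx hy ⟨D, hD, hD0⟩ ⟨E, hE, hE0⟩
    refine ⟨D + E, fun z => ?_, ?_⟩
    · rw [Scheme.ord_mul hx hy, hD, hE, Finsupp.add_apply]
    · rw [Finsupp.sum_add_index' (by simp) (by simp), hD0, hE0, add_zero]
  · rintro x hx ⟨D, hD, hD0⟩
    refine ⟨-D, fun z => ?_, ?_⟩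
    · have h1 : C.scheme.ord (x * x⁻¹) z = 0 := by
        rw [mul_inv_cancel₀ hx]
        have := C.scheme.ord_mul (x := z) (one_ne_zero (α := C.scheme.functionField)) one_ne_zero
        rw [mul_one] at this
        omega
      rw [Scheme.ord_mul hx (inv_ne_zero hx), hD] at h1
      rw [Finsupp.neg_apply]
      omega
    · rw [Finsupp.sum_neg_index (by simp)]
      simp only [Finsupp.sum, Finset.sum_neg_distrib, neg_eq_zero]
      exact hD0

end ProjectiveVariety

/-! ### Filtrations by order of vanishing -/

section OrderFunction

variable {k M : Type*} [Field k] [AddCommGroup M] [Module k M]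

variable (k) in
/-- `w` is an order of vanishing on the vector space `M` with one-dimensional graded pieces, whose
values lie in the semigroup `S`. The value at `0` is irrelevant. -/
structure IsOrderFunction (S : AddSubmonoid ℕ) (w : M → ℤ) : Prop where
  exists_mem (x : M) (hx : x ≠ 0) : ∃ m ∈ S, (m : ℤ) = w x
  min_le_add (x y : M) (hx : x ≠ 0) (hy : y ≠ 0) (hxy : x + y ≠ 0) : min (w x) (w y) ≤ w (x + y)
  smul (c : k) (x : M) (hc : c ≠ 0) (hx : x ≠ 0) : w (c • x) = w x
  exists_sub (x y : M) (hx : x ≠ 0) (hy : y ≠ 0) (h : w x = w y) :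
    ∃ c : k, x - c • y = 0 ∨ w y < w (x - c • y)

namespace IsOrderFunction

variable {S : AddSubmonoid ℕ} {w : M → ℤ} (hw : IsOrderFunction k S w)

/-- The elements of order at least `n`. -/
def level (n : ℤ) : Submodule k M where
  carrier := {x | x = 0 ∨ n ≤ w x}
  zero_mem' := Or.inl rfl
  add_mem' := by
    intro x y hx hy
    by_cases hx0 : x = 0
    · rwa [hx0, zero_add]
    by_cases hy0 : y = 0
    · rwa [hy0, add_zero]
    by_cases hxy : x + y = 0
    · exact Or.inl hxy
    have hx := hx.resolve_left hx0
    have hy := hy.resolve_left hy0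
    exact Or.inr ((le_min hx hy).trans (hw.min_le_add x y hx0 hy0 hxy))
  smul_mem' := by
    intro c x hx
    by_cases hx0 : x = 0
    · exact Or.inl (by simp [hx0])
    by_cases hc : c = 0
    · exact Or.inl (by simp [hc])
    have hx := hx.resolve_left hx0
    exact Or.inr (by rwa [hw.smul c x hc hx0])

lemma mem_level_iff {n : ℤ} {x : M} : x ∈ hw.level n ↔ x = 0 ∨ n ≤ w x := Iff.rfl

include hw in
lemma nonneg {x : M} (hx : x ≠ 0) : 0 ≤ w x := by
  obtain ⟨m, -, hm⟩ := hw.exists_mem x hx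
  omega

lemma level_eq_top {n : ℤ} (hn : n ≤ 0) : hw.level n = ⊤ := by
  refine eq_top_iff.mpr fun x _ => ?_
  by_cases hx : x = 0
  · exact Or.inl hx
  · exact Or.inr (hn.trans (hw.nonneg hx))

lemma level_succ_of_notMem {n : ℕ} (hn : n ∉ S) : hw.level n ≤ hw.level (n + 1 : ℤ) := by
  intro x hx
  by_cases hx0 : x = 0
  · exact Or.inl hx0
  have hx := hx.resolve_left hx0
  obtain ⟨m, hm, hmx⟩ := hw.exists_mem x hx0
  have : m ≠ n := by rintro rfl; exact hn hm
  exact Or.inr (by omega)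

/-- Elements of exact order `n` are proportional modulo higher order, so one such `y` spans
everything that is lost at the next level. -/
lemma finrank_level_succ (N : Submodule k M) [Module.Finite k N] (n : ℤ) :
    Module.finrank k (N ⊓ hw.level n : Submodule k M) ≤
      Module.finrank k (N ⊓ hw.level (n + 1) : Submodule k M) + 1 := by
  by_cases h : ∀ x ∈ N ⊓ hw.level n, x ∈ hw.level (n + 1)
  · have : N ⊓ hw.level n ≤ N ⊓ hw.level (n + 1) := fun x hx => ⟨hx.1, h x hx⟩
    have := Submodule.finrank_mono this
    omega
  push Not at h
  obtain ⟨y, ⟨hyN, hyn⟩, hy⟩ := h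
  rw [hw.mem_level_iff, not_or, not_le] at hy
  have hwy : w y = n := by
    have := hyn.resolve_left hy.1
    omega
  have hle : N ⊓ hw.level n ≤ (N ⊓ hw.level (n + 1)) ⊔ Submodule.span k {y} := by
    rintro x ⟨hxN, hxn⟩
    by_cases hx : x ∈ hw.level (n + 1)
    · exact Submodule.mem_sup_left ⟨hxN, hx⟩
    rw [hw.mem_level_iff, not_or, not_le] at hx
    have hwx : w x = n := by
      have := hxn.resolve_left hx.1
      omega
    obtain ⟨c, hc⟩ := hw.exists_sub x y hx.1 hy.1 (hwx.trans hwy.symm)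
    have hmem : x - c • y ∈ N ⊓ hw.level (n + 1) := by
      refine ⟨sub_mem hxN (N.smul_mem c hyN), hc.imp id fun h => ?_⟩
      omega
    rw [← sub_add_cancel x (c • y)]
    exact add_mem (Submodule.mem_sup_left hmem) (Submodule.mem_sup_right
      (Submodule.smul_mem _ c (Submodule.mem_span_singleton_self y)))
  calc Module.finrank k (N ⊓ hw.level n : Submodule k M)
      ≤ Module.finrank k ((N ⊓ hw.level (n + 1)) ⊔ Submodule.span k {y} : Submodule k M) :=
        Submodule.finrank_mono hle
    _ ≤ Module.finrank k (N ⊓ hw.level (n + 1) : Submodule k M) +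
        Module.finrank k (Submodule.span k {y}) := Submodule.finrank_add_le_finrank_add_finrank _ _
    _ ≤ _ := by
        have := finrank_span_singleton (K := k) hy.1
        omega

lemma _root_.semigroupCount_succ (S : AddSubmonoid ℕ) [DecidablePred (· ∈ S)] (n : ℕ) :
    semigroupCount S (n + 1 : ℤ) = semigroupCount S n + if n ∈ S then 1 else 0 := by
  have hfin : {m : ℕ | m ∈ S ∧ (m : ℤ) < n}.Finite :=
    (Set.finite_lt_nat n).subset fun m hm => by simpa using hm.2
  unfold semigroupCount
  split_ifs with h
  · have : {m : ℕ | m ∈ S ∧ (m : ℤ) < n + 1} = insert n {m : ℕ | m ∈ S ∧ (m : ℤ) < n} := by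
      ext m
      simp only [Set.mem_ofPred_eq, Set.mem_insert_iff]
      constructor
      · rintro ⟨h1, h2⟩
        by_cases hm : m = n
        · exact Or.inl hm
        · exact Or.inr ⟨h1, by omega⟩
      · rintro (rfl | ⟨h1, h2⟩)
        · exact ⟨h, by omega⟩
        · exact ⟨h1, by omega⟩
    rw [this, Set.ncard_insert_of_notMem (by simp) hfin]
    push_cast; ring
  · have : {m : ℕ | m ∈ S ∧ (m : ℤ) < n + 1} = {m : ℕ | m ∈ S ∧ (m : ℤ) < n} := by
      ext m
      simp only [Set.mem_ofPred_eq]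
      constructor
      · rintro ⟨h1, h2⟩
        have : m ≠ n := by rintro rfl; exact h h1
        exact ⟨h1, by omega⟩
      · rintro ⟨h1, h2⟩
        exact ⟨h1, by omega⟩
    rw [this, add_zero]

/-- The subspace of elements of order at least `n` has codimension at most `R_S(n)`. -/
lemma finrank_le (N : Submodule k M) [Module.Finite k N] (n : ℤ) :
    (Module.finrank k N : ℤ) ≤
      Module.finrank k (N ⊓ hw.level n : Submodule k M) + semigroupCount S n := by
  classical
  rcases le_or_gt n 0 with hn | hn
  · rw [hw.level_eq_top hn, inf_top_eq]
    have : 0 ≤ semigroupCount S n := Int.natCast_nonneg _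
    omega
  lift n to ℕ using hn.le
  clear hn
  induction n with
  | zero =>
    rw [Nat.cast_zero, hw.level_eq_top le_rfl, inf_top_eq]
    have : 0 ≤ semigroupCount S 0 := Int.natCast_nonneg _
    omega
  | succ n ih =>
    rw [Nat.cast_succ, semigroupCount_succ]
    -- The level can shrink from `n` to `n + 1` only when `n ∈ S`, and this is exactly when the
    -- count goes up by one.
    split_ifs with h
    · have := hw.finrank_level_succ N n
      omega
    · have := Submodule.finrank_mono (inf_le_inf_left N (hw.level_succ_of_notMem h))
      omega

end IsOrderFunction

/-- If a space of sections is larger than `R_{S₁} ⋄ … ⋄ R_{Sₙ}` at `s`, then it contains a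
nonzero section for which the orders of vanishing sum up to at least `s`. -/
theorem exists_le_sum_of_countingFunction_lt {ι : Type*} (S : ι → AddSubmonoid ℕ) (w : ι → M → ℤ)
    (l : List ι) (hl : l ≠ []) (hw : ∀ i ∈ l, IsOrderFunction k (S i) (w i)) (s : ℤ)
    (N : Submodule k M) [Module.Finite k N]
    (h : countingFunction (l.map S) s < Module.finrank k N) :
    ∃ x ∈ N, x ≠ 0 ∧ s ≤ (l.map fun i => w i x).sum := by
  induction l generalizing s N with
  | nil => exact absurd rfl hl
  | cons i l ih =>
    have hwi := hw i (by simp)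
    cases l with
    | nil =>
      change semigroupCount (S i) s < _ at h
      have h1 := hwi.finrank_le N s
      obtain ⟨x, ⟨hxN, hxs⟩, hx⟩ := Submodule.exists_mem_ne_zero_of_ne_bot
        (p := N ⊓ hwi.level s) (by
          intro hbot
          rw [hbot, finrank_bot] at h1
          omega)
      exact ⟨x, hxN, hx, by simpa using hxs.resolve_left hx⟩
    | cons j l =>
      change (⨅ m : ℤ, (semigroupCount (S i) m + countingFunction ((j :: l).map S) (s - m))) < _
        at h
      -- Some split of `s` into `m` and `s - m` already costs less than the dimension. Requiring
      -- order at least `m` for `i` leaves a subspace still too large for the remaining indices at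
      -- `s - m`.
      obtain ⟨m, hm⟩ := exists_lt_of_ciInf_lt h
      have h1 := hwi.finrank_le N m
      obtain ⟨x, ⟨hxN, hxm⟩, hx, hsum⟩ := ih (by simp) (fun i' hi' => hw i' (by simp [hi'])) (s - m)
        (N ⊓ hwi.level m) (by omega)
      refine ⟨x, hxN, hx, ?_⟩
      have := hxm.resolve_left hx
      rw [List.map_cons, List.sum_cons]
      omega

/-- A vector space all of whose finite-dimensional subspaces have dimension at most `B` is
finite-dimensional, of dimension at most `B`. -/
lemma finite_and_finrank_le_of_forall_submodule {B : ℤ}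
    (h : ∀ N : Submodule k M, Module.Finite k N → (Module.finrank k N : ℤ) ≤ B) :
    Module.Finite k M ∧ (Module.finrank k M : ℤ) ≤ B := by
  have hB : 0 ≤ B := by simpa using h ⊥ inferInstance
  lift B to ℕ using hB
  have hrank : Module.rank k M ≤ B := by
    refine rank_le fun s hs => ?_
    have h1 := h (Submodule.span k (s : Set M)) inferInstance
    rw [finrank_span_finset_eq_card hs] at h1
    exact_mod_cast h1
  have hfin : Module.Finite k M :=
    Module.rank_lt_aleph0_iff.mp (hrank.trans_lt (Cardinal.natCast_lt_aleph0))
  refine ⟨hfin, ?_⟩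
  rw [← Module.finrank_eq_rank] at hrank
  exact_mod_cast hrank

end OrderFunction

/-! ### Coefficients of sections with respect to frames -/

section Frames

variable {X : Scheme.{0}} {L : X.Modules}

lemma resSection_smul {U V : X.Opens} (h : V ≤ U) (r : Γ(X, U)) (e : Γ(L, U)) :
    resSection L h (r • e) = X.presheaf.map (homOfLE h).op r • resSection L h e :=
  Scheme.Modules.map_smul L (homOfLE h) r e

lemma resSection_resSection {U V W : X.Opens} (h : V ≤ U) (h' : W ≤ V) (e : Γ(L, U)) :
    resSection L h' (resSection L h e) = resSection L (h'.trans h) e :=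
  (ConcreteCategory.congr_hom (L.presheaf.map_comp (homOfLE h).op (homOfLE h').op) e).symm

lemma resSection_self {U : X.Opens} (e : Γ(L, U)) : resSection L le_rfl e = e :=
  ConcreteCategory.congr_hom (L.presheaf.map_id (.op U)) e

lemma resSection_add {U V : X.Opens} (h : V ≤ U) (e f : Γ(L, U)) :
    resSection L h (e + f) = resSection L h e + resSection L h f :=
  map_add _ _ _

/-- The coefficient of a global section with respect to a frame. -/
def frameCoeff {U : X.Opens} {e : Γ(L, U)} (he : IsFrame L U e) (u : Γ(L, ⊤)) : Γ(X, U) :=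
  ((he U le_rfl).2 (resSection L le_top u)).choose

variable {C : Scheme.{0}} (i : C ⟶ X) {U : X.Opens} {e : Γ(L, U)} (he : IsFrame L U e)

lemma frameCoeff_smul_eq (u : Γ(L, ⊤)) : frameCoeff he u • e = resSection L le_top u := by
  have h : frameCoeff he u • resSection L le_rfl e = resSection L le_top u :=
    ((he U le_rfl).2 (resSection L le_top u)).choose_spec
  rwa [resSection_self] at h

lemma IsFrame.smul_injective {a b : Γ(X, U)} (he : IsFrame L U e) (h : a • e = b • e) : a = b := by
  refine (he U le_rfl).1 ?_
  simpa only [resSection_self] using h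

lemma frameCoeff_eq {u : Γ(L, ⊤)} {a : Γ(X, U)} (h : resSection L le_top u = a • e) :
    frameCoeff he u = a :=
  he.smul_injective ((frameCoeff_smul_eq he u).trans h)

lemma frameCoeff_add (u v : Γ(L, ⊤)) : frameCoeff he (u + v) = frameCoeff he u + frameCoeff he v :=
  frameCoeff_eq he (by
    rw [resSection_add, add_smul, frameCoeff_smul_eq, frameCoeff_smul_eq])

lemma frameCoeff_smul (r : Γ(X, ⊤)) (u : Γ(L, ⊤)) :
    frameCoeff he (r • u) = X.presheaf.map (homOfLE le_top).op r * frameCoeff he u :=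
  frameCoeff_eq he (by rw [resSection_smul, mul_smul, frameCoeff_smul_eq])

lemma IsFrame.resSection {V : X.Opens} (he : IsFrame L U e) (h : V ≤ U) :
    IsFrame L V (resSection L h e) := by
  intro W hW
  have := he W (hW.trans h)
  simpa only [resSection_resSection] using this

lemma map_frameCoeff_eq {V : X.Opens} {f : Γ(L, V)} (hf : IsFrame L V f) {a : Γ(X, U ⊓ V)}
    (ha : resSection L (inf_le_left : U ⊓ V ≤ U) e =
      a • resSection L (inf_le_right : U ⊓ V ≤ V) f) (u : Γ(L, ⊤)) :
    X.presheaf.map (homOfLE (inf_le_right : U ⊓ V ≤ V)).op (frameCoeff hf u) =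
      a * X.presheaf.map (homOfLE (inf_le_left : U ⊓ V ≤ U)).op (frameCoeff he u) := by
  refine (hf.resSection inf_le_right).smul_injective ?_
  rw [← resSection_smul, frameCoeff_smul_eq, resSection_resSection, mul_comm, mul_smul, ← ha,
    ← resSection_smul, frameCoeff_smul_eq, resSection_resSection]

/-- The coefficient of the pullback of a global section along `i : C ⟶ X`, in the local ring
at `z`. -/
def stalkCoeff {U : X.Opens} {e : Γ(L, U)} (he : IsFrame L U e) {z : C} (hz : z ∈ i ⁻¹ᵁ U)
    (u : Γ(L, ⊤)) : C.presheaf.stalk z :=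
  C.presheaf.germ (i ⁻¹ᵁ U) z hz (i.app U (frameCoeff he u))

lemma stalkCoeff_add {z : C} (hz : z ∈ i ⁻¹ᵁ U) (u v : Γ(L, ⊤)) :
    stalkCoeff i he hz (u + v) = stalkCoeff i he hz u + stalkCoeff i he hz v := by
  rw [stalkCoeff, frameCoeff_add, map_add, map_add]
  rfl

lemma germ_app_map {U V : X.Opens} (h : V ≤ U) {z : C} (hz : z ∈ i ⁻¹ᵁ V) (r : Γ(X, U)) :
    C.presheaf.germ (i ⁻¹ᵁ V) z hz (i.app V (X.presheaf.map (homOfLE h).op r)) =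
      C.presheaf.germ (i ⁻¹ᵁ U) z (show z ∈ i ⁻¹ᵁ U from h hz) (i.app U r) := by
  have h1 : i.app V (X.presheaf.map (homOfLE h).op r) =
      C.presheaf.map ((Opens.map i.base).map (homOfLE h)).op (i.app U r) :=
    ConcreteCategory.congr_hom (i.naturality (homOfLE h).op) r
  rw [h1]
  exact C.presheaf.germ_res_apply _ _ _ _

lemma stalkCoeff_smul {z : C} (hz : z ∈ i ⁻¹ᵁ U) (r : Γ(X, ⊤)) (u : Γ(L, ⊤)) :
    stalkCoeff i he hz (r • u) =
      C.presheaf.germ ⊤ z trivial (i.appTop r) * stalkCoeff i he hz u := by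
  rw [stalkCoeff, frameCoeff_smul, map_mul, map_mul, germ_app_map i le_top hz]
  rfl

lemma stalkCoeff_change {V : X.Opens} {f : Γ(L, V)} (hf : IsFrame L V f) {a : Γ(X, U ⊓ V)}
    (ha : resSection L (inf_le_left : U ⊓ V ≤ U) e =
      a • resSection L (inf_le_right : U ⊓ V ≤ V) f) {z : C} (hU : z ∈ i ⁻¹ᵁ U)
    (hV : z ∈ i ⁻¹ᵁ V) (u : Γ(L, ⊤)) :
    stalkCoeff i hf hV u = C.presheaf.germ (i ⁻¹ᵁ (U ⊓ V)) z ⟨hU, hV⟩ (i.app (U ⊓ V) a) *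
      stalkCoeff i he hU u := by
  have h := congrArg (fun r => C.presheaf.germ (i ⁻¹ᵁ (U ⊓ V)) z ⟨hU, hV⟩ (i.app (U ⊓ V) r))
    (map_frameCoeff_eq he hf ha u)
  simp only [map_mul] at h
  rw [germ_app_map i inf_le_right ⟨hU, hV⟩, germ_app_map i inf_le_left ⟨hU, hV⟩] at h
  exact h

lemma algebraMap_stalkCoeff [IsIntegral C] {z : C} (hz : z ∈ i ⁻¹ᵁ U) (u : Γ(L, ⊤)) :
    algebraMap (C.presheaf.stalk z) C.functionField (stalkCoeff i he hz u) =
      stalkCoeff i he (genericPoint_mem_preimage i hz) u :=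
  C.presheaf.germ_stalkSpecializes_apply hz ((genericPoint_spec C).specializes trivial) _

/-- A change of frame multiplies both coefficients by the same function, so the quotient of `u` by
`s` does not depend on the frame. -/
lemma coeff_mul_stalkCoeff [IsIntegral C] (s : RationalSection i L) {V : X.Opens} {f : Γ(L, V)}
    (hf : IsFrame L V f) (hU : genericPoint C ∈ i ⁻¹ᵁ U) (hV : genericPoint C ∈ i ⁻¹ᵁ V)
    (u : Γ(L, ⊤)) :
    stalkCoeff i hf hV u * s.coeff U e he hU = stalkCoeff i he hU u * s.coeff V f hf hV := by
  obtain ⟨a, ha⟩ := (hf (U ⊓ V) inf_le_right).2 (resSection L inf_le_left e)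
  rw [stalkCoeff_change i he hf ha.symm hU hV, s.coeff_change U V e f he hf hU hV a ha.symm]
  ring

/-- In a frame witnessing nonvanishing at `x` the coefficient is a unit of the local ring, hence
nonzero generically. A zero coefficient in another frame would make this one zero as well. -/
lemma stalkCoeff_ne_zero_of_not_vanishesAt [IsIntegral C] {u : Γ(L, ⊤)} {x : C}
    (hx : ¬ VanishesAt L u (i x)) (hU : genericPoint C ∈ i ⁻¹ᵁ U) :
    stalkCoeff i he hU u ≠ 0 := by
  unfold VanishesAt at hx
  push Not at hx
  obtain ⟨V, hxV, f, hf, a, ha, hxa⟩ := hx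
  have hunit : IsUnit (stalkCoeff i hf (z := x) hxV u) := by
    unfold stalkCoeff
    rw [frameCoeff_eq hf ha]
    have h1 : x ∈ i ⁻¹ᵁ X.basicOpen a := hxa
    rw [Scheme.preimage_basicOpen] at h1
    exact (C.mem_basicOpen (i.app V a) x hxV).mp h1
  have hne : stalkCoeff i hf (genericPoint_mem_preimage i hxV) u ≠ 0 := by
    rw [← algebraMap_stalkCoeff i hf (z := x) hxV]
    exact (hunit.map (algebraMap _ C.functionField)).ne_zero
  intro h0
  obtain ⟨b, hb⟩ := (hf (U ⊓ V) inf_le_right).2 (resSection L inf_le_left e)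
  apply hne
  rw [stalkCoeff_change i he hf hb.symm hU (genericPoint_mem_preimage i hxV), h0, mul_zero]

end Frames

/-! ### Orders of vanishing of sections along a curve -/

section Sections

variable {X C : ProjectiveVariety} {i : C.scheme ⟶ X.scheme} {L : X.scheme.Modules}

/-- The quotient of the restriction of a global section of `L` to `C` by a rational section. -/
def sectionQuotient (hiX : i ≫ X.hom = C.hom) (s : RationalSection i L)
    {U : X.scheme.Opens} {e : Γ(L, U)} (he : IsFrame L U e)
    (hU : genericPoint C.scheme ∈ i ⁻¹ᵁ U) :
    GlobalSections X L →ₗ[ℂ] C.scheme.functionField where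
  toFun u := stalkCoeff i he hU u / s.coeff U e he hU
  map_add' u v := by
    rw [← add_div]
    exact congrArg (· / _) (stalkCoeff_add i he hU u v)
  map_smul' c u := by
    rw [RingHom.id_apply, Algebra.smul_def, mul_div_assoc']
    refine congrArg (· / _) ((stalkCoeff_smul i he hU (X.constants c) u).trans ?_)
    congr 1
    rw [ProjectiveVariety.algebraMap_stalk_apply]
    congr 1
    change ((Scheme.ΓSpecIso (.of ℂ)).inv ≫ X.hom.appTop ≫ i.appTop) c =
      ((Scheme.ΓSpecIso (.of ℂ)).inv ≫ C.hom.appTop) c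
    rw [← Scheme.Hom.comp_appTop, hiX]

variable (hiX : i ≫ X.hom = C.hom) (s : RationalSection i L) {U : X.scheme.Opens} {e : Γ(L, U)}
  (he : IsFrame L U e) (hU : genericPoint C.scheme ∈ i ⁻¹ᵁ U)

lemma sectionQuotient_mul_coeff {V : X.scheme.Opens} {f : Γ(L, V)} (hf : IsFrame L V f)
    (hV : genericPoint C.scheme ∈ i ⁻¹ᵁ V) (u : GlobalSections X L) :
    sectionQuotient hiX s he hU u * s.coeff V f hf hV = stalkCoeff i hf hV u := by
  change stalkCoeff i he hU u / s.coeff U e he hU * s.coeff V f hf hV = stalkCoeff i hf hV u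
  rw [div_mul_eq_mul_div, div_eq_iff (s.coeff_ne_zero U e he hU)]
  exact (coeff_mul_stalkCoeff i he s hf hU hV u).symm

lemma sectionQuotient_ne_zero
    (hvan : ∀ u : GlobalSections X L, (∀ x : C.scheme, VanishesAt L u (i x)) → u = 0)
    {u : GlobalSections X L} (hu : u ≠ 0) : sectionQuotient hiX s he hU u ≠ 0 := by
  have h := mt (hvan u) hu
  push Not at h
  obtain ⟨x, hx⟩ := h
  exact div_ne_zero (stalkCoeff_ne_zero_of_not_vanishesAt i he hx hU) (s.coeff_ne_zero U e he hU)

open IntermediateField in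
/-- The order of vanishing at a unibranch point takes its values in the semigroup of the point. -/
theorem isOrderFunction_ord_sectionQuotient (hL : IsLineBundle L) (hcusp : IsCuspidal C.scheme)
    {T : C.scheme.functionField} (hT : ℂ⟮T⟯ = ⊤)
    (hvan : ∀ u : GlobalSections X L, (∀ x : C.scheme, VanishesAt L u (i x)) → u = 0)
    {D : C.scheme →₀ ℤ} (hD : IsDivisorOf s D) {z : C.scheme} (hz : Order.coheight z = 1) :
    IsOrderFunction ℂ (pointSemigroup z)
      fun u => C.scheme.ord (sectionQuotient hiX s he hU u) z + D z := by
  have : Ring.KrullDimLE 1 (C.scheme.presheaf.stalk z) := krullDimLE_of_coheight_le hz.le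
  obtain ⟨π, hπ, hfg, -⟩ := ProjectiveVariety.exists_uniformizer hcusp hT hz
  set ρ := sectionQuotient hiX s he hU with hρ
  have hne {u : GlobalSections X L} (hu : u ≠ 0) : ρ u ≠ 0 :=
    sectionQuotient_ne_zero hiX s he hU hvan hu
  refine ⟨fun u hu => ?_, fun u v hu hv huv => ?_, fun c u hc hu => ?_, fun u v hu hv huv => ?_⟩
  · obtain ⟨V, hzV, f, hf⟩ := hL (i z)
    have hV := genericPoint_mem_preimage i hzV
    -- In a frame around `z`, `D z` is the order of `s`, so the denominator cancels and the order of
    -- an element of `𝒪_{C,z}` remains; its length is in the semigroup.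
    have h1 : C.scheme.ord (ρ u) z + D z = C.scheme.ord (stalkCoeff i hf hV u) z := by
      rw [hD z V hzV f hf, ← Scheme.ord_mul (hne hu) (s.coeff_ne_zero V f hf hV),
        sectionQuotient_mul_coeff]
    have h2 : stalkCoeff i hf hV u ≠ 0 := by
      rw [← sectionQuotient_mul_coeff hiX s he hU]
      exact mul_ne_zero (hne hu) (s.coeff_ne_zero V f hf hV)
    have h3 := algebraMap_stalkCoeff i hf (z := z) hzV u
    have h4 : stalkCoeff i hf (z := z) hzV u ≠ 0 := by
      intro h
      rw [h, map_zero] at h3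
      exact h2 h3.symm
    obtain ⟨m, hm⟩ := ENat.ne_top_iff_exists.mp
      (Ring.ord_ne_top (mem_nonZeroDivisors_of_ne_zero h4))
    refine ⟨m, ⟨_, h4, hm.symm⟩, ?_⟩
    rw [h1, eq_comm, Scheme.ord_eq_iff hz h2, ← h3]
    change Ring.ordFrac _ _ = _
    rw [Ring.ordFrac_eq_ord _ h4,
      Ring.ordMonoidWithZeroHom_eq_coe _ (mem_nonZeroDivisors_of_ne_zero h4) hm.symm]
  · have h1 := hπ.min_ordFrac_le_add hfg (x := ρ u) (y := ρ v)
      (by rw [← map_add]; exact hne huv)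
    rw [min_add_add_right, map_add]
    refine add_le_add_left ?_ _
    rw [min_le_iff, ← map_add] at h1 ⊢
    rw [Scheme.ord_le_ord_iff hz hz (hne hu) (hne huv),
      Scheme.ord_le_ord_iff hz hz (hne hv) (hne huv)]
    exact h1
  · rw [map_smul, Algebra.smul_def, Scheme.ord_mul (by simpa using hc) (hne hu)]
    have : C.scheme.ord (algebraMap ℂ _ c) z = 0 := by
      rw [Scheme.ord_eq_iff hz (by simpa using hc), ProjectiveVariety.ordHom_algebraMap hz hc]
      rfl
    rw [this, zero_add]
  · have h1 : C.scheme.ordHom z hz (ρ u) = C.scheme.ordHom z hz (ρ v) := by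
      refine le_antisymm ?_ ?_
      · rw [← Scheme.ord_le_ord_iff hz hz (hne hu) (hne hv)]
        omega
      · rw [← Scheme.ord_le_ord_iff hz hz (hne hv) (hne hu)]
        omega
    obtain ⟨c, hc⟩ := hπ.exists_sub_eq_zero_or_lt hfg (hne hv) h1
    refine ⟨c, ?_⟩
    by_cases h0 : u - c • v = 0
    · exact Or.inl h0
    right
    have h2 : ρ (u - c • v) = ρ u - algebraMap ℂ _ c * ρ v := by
      rw [map_sub, map_smul, Algebra.smul_def]
    rw [← h2] at hc
    have h3 := hc.resolve_left (hne h0)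
    refine add_lt_add_left ?_ _
    rw [← not_le, Scheme.ord_le_ord_iff hz hz (hne h0) (hne hv), not_le]
    exact h3

open IntermediateField in
/-- The orders of vanishing of a section along `C` at distinct points add up to at most the degree
of the line bundle. -/
theorem sum_ord_sectionQuotient_le (hL : IsLineBundle L)
    (hC : topologicalKrullDim C.scheme = 1) (hcusp : IsCuspidal C.scheme)
    {T : C.scheme.functionField} (hT : ℂ⟮T⟯ = ⊤)
    (hvan : ∀ u : GlobalSections X L, (∀ x : C.scheme, VanishesAt L u (i x)) → u = 0)
    {D : C.scheme →₀ ℤ} (hD : IsDivisorOf s D) {z₀ : C.scheme} (hz₀ : Order.coheight z₀ = 1)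
    {l : List C.scheme} (hl : l.Nodup) {u : GlobalSections X L} (hu : u ≠ 0) :
    (l.map fun z => C.scheme.ord (sectionQuotient hiX s he hU u) z + D z).sum ≤
      D.sum fun _ m => m := by
  classical
  obtain ⟨E, hE, hE0⟩ := ProjectiveVariety.exists_principalDivisor hC hcusp hT hz₀ _
    (sectionQuotient_ne_zero hiX s he hU hvan hu)
  -- `E + D` is the divisor of `u|_C`. It is effective, so its part on the given points is at most
  -- its degree, which is that of `D`.
  have hnonneg (z : C.scheme) : 0 ≤ (E + D) z := by
    rw [Finsupp.add_apply, ← hE]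
    by_cases hz : Order.coheight z = 1
    · exact (isOrderFunction_ord_sectionQuotient hiX s he hU hL hcusp hT hvan hD hz).nonneg hu
    · obtain ⟨V, hzV, f, hf⟩ := hL (i z)
      rw [hD z V hzV f hf]
      simp [hz]
  have hsum : ((E + D).sum fun _ m => m) = D.sum fun _ m => m := by
    rw [Finsupp.sum_add_index' (by simp) (by simp), hE0, zero_add]
  have hlist : (l.map fun z => C.scheme.ord (sectionQuotient hiX s he hU u) z + D z).sum =
      ∑ z ∈ l.toFinset, (E + D) z := by
    rw [List.sum_toFinset _ hl]
    simp only [Finsupp.add_apply, hE]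
  rw [hlist, ← hsum, Finsupp.sum]
  calc ∑ z ∈ l.toFinset, (E + D) z ≤ ∑ z ∈ l.toFinset ∪ (E + D).support, (E + D) z :=
        Finset.sum_le_sum_of_subset_of_nonneg Finset.subset_union_left fun z _ _ => hnonneg z
    _ = _ := by
        refine (Finset.sum_subset Finset.subset_union_right fun z _ hz => ?_).symm
        simpa using hz

end Sections

end

/-! ### The main inequality -/

theorem theorem3
    (X C : ProjectiveVariety) (hX : topologicalKrullDim X.scheme = 2)
    (hC : topologicalKrullDim C.scheme = 1)
    (i : C.scheme ⟶ X.scheme) (hi : IsClosedImmersion i) (hiX : i ≫ X.hom = C.hom)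
    (hrat : Scheme.BirationalOver C.hom (𝔸(PUnit; Spec (.of ℂ)) ↘ Spec (.of ℂ)))
    (hcusp : IsCuspidal C.scheme)
    (z : List C.scheme) (hz_nodup : z.Nodup)
    (hz : ∀ x : C.scheme, x ∈ z ↔ IsSingularPoint C.scheme x)
    (L : X.scheme.Modules) (hL : IsLineBundle L)
    (t : ℤ) (ht : IsDegree i L t) (ht_pos : 0 < t)
    (hsec : Nontrivial (GlobalSections X L))
    (hvan : ∀ u : GlobalSections X L, (∀ x : C.scheme, VanishesAt L u (i x)) → u = 0) :
    Module.Finite ℂ (GlobalSections X L) ∧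
      (Module.finrank ℂ (GlobalSections X L) : ℤ) ≤
        countingFunction (z.map pointSemigroup) (t + 1) := by
  obtain ⟨T, hT⟩ := exists_adjoin_simple_eq_top C hrat
  obtain ⟨s, D, hD, rfl⟩ := ht
  obtain ⟨U, hU, e, he⟩ := hL (i (genericPoint C.scheme))
  -- Orders vanish outside codimension one, so without such a point `D` would be zero, against `t >
  -- 0`.
  obtain ⟨z₀, hz₀⟩ : ∃ z₀ : C.scheme, Order.coheight z₀ = 1 := by
    by_contra! h
    have : D = 0 := Finsupp.ext fun z => by
      obtain ⟨V, hzV, f, hf⟩ := hL (i z)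
      rw [hD z V hzV f hf, Scheme.ord_eq_zero_of_coheight_neq_one (h z), Finsupp.zero_apply]
    rw [this, Finsupp.sum_zero_index] at ht_pos
    exact lt_irrefl 0 ht_pos
  refine finite_and_finrank_le_of_forall_submodule fun N _ => ?_
  by_contra! hlt
  -- Total order at least `t + 1` contradicts the bound `t`. Semigroups larger than the true ones
  -- are allowed so that the smooth case may use `⊤`.
  have key (l : List C.scheme) (hl : l ≠ []) (hnd : l.Nodup) (S : C.scheme → AddSubmonoid ℕ)
      (hS : ∀ z ∈ l, Order.coheight z = 1 ∧ pointSemigroup z ≤ S z) :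
      ¬ countingFunction (l.map S) ((D.sum fun _ m => m) + 1) < Module.finrank ℂ N := by
    intro h
    obtain ⟨u, -, hu, hsum⟩ := exists_le_sum_of_countingFunction_lt S
      (fun z u => C.scheme.ord (sectionQuotient hiX s he hU u) z + D z) l hl
      (fun z hz => by
        have h := isOrderFunction_ord_sectionQuotient hiX s he hU hL hcusp hT hvan hD (hS z hz).1
        exact { h with
          exists_mem := fun x hx => (h.exists_mem x hx).imp fun m hm => ⟨(hS z hz).2 hm.1, hm.2⟩ })
      _ N h
    have := sum_ord_sectionQuotient_le hiX s he hU hL hC hcusp hT hvan hD hz₀ hnd hu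
    omega
  by_cases hnil : z = []
  · subst hnil
    -- The counting functions of `[]` and `[⊤]` coincide by definition, so a smooth curve is treated
    -- by vanishing at the single point `z₀`.
    exact key [z₀] (by simp) (List.nodup_singleton z₀) (fun _ => ⊤)
      (fun x hx => ⟨by rwa [List.mem_singleton.mp hx], le_top⟩) hlt
  · refine key z hnil hz_nodup pointSemigroup (fun x hx => ⟨?_, le_rfl⟩) hlt
    -- The generic point is not singular, because its local ring is a field.
    refine coheight_eq_one_of_ne_genericPoint hC ?_
    rintro rfl
    refine (hz _).mp hx ?_
    exact inferInstanceAs (IsRegularLocalRing C.scheme.functionField)
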